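/- Let $L>0$ and $a,b,c\in\mathbb R$, and consider on $[0,\infty)\times[0,L]$ the coupled linear KdV--ODE system $$ \begin{cases} y_t+y_x+y_{xxx}=0,\\ y(t,0)=y(t,L)=0,\qquad y_x(t,L)=a\,z(t),\\ \dot z(t)=b\,z(t)+c\,y_x(t,0),\\ y(0,\cdot)=y_0,\qquad z(0)=z_0 . \end{cases}\tag{S} $$ (i) For every $(y_0,z_0)\in H^3(0,L)\times\mathbb R$ satisfying the compatibility conditions $y_0(0)=y_0(L)=0$ and $y_0'(L)=a z_0$, there exists a unique strong solution $(y,z)$ of (S) with $$y\in C(\mathbb R_+;H^3(0,L))\cap C^1(\mathbb R_+;L^2(0,L)),\qquad z\in C^1(\mathbb R_+),$$ that is, the KdV equation holds in $L^2(0,L)$ for every $t\ge 0$, and the boundary conditions, the ODE and the initial conditions hold for every $t\ge0$ in the sense of traces. (ii) For every $(y_0,z_0)\in L^2(0,L)\times\mathbb R$ there exists a unique weak solution $(y,z)$ of (S) with $$y\in C(\mathbb R_+;L^2(0,L)),\qquad z\in C(\mathbb R_+).$$ Here $(y,z)$ is a weak solution if $y(0)=y_0$, $z(0)=z_0$ and,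 for every $\varphi\in C^\infty([0,L])$ and $q\in\mathbb R$ with $\varphi(0)=\varphi(L)=0$ and $\varphi'(0)=c\,q$, and every $t\ge 0$, $$ \int_0^L y(t,x)\varphi(x)\,dx+z(t)q=\int_0^L y_0\varphi\,dx+z_0q+\int_0^t\Big(\int_0^L y(s,x)\big(\varphi'(x)+\varphi'''(x)\big)dx+z(s)\big(bq+a\varphi'(L)\big)\Big)ds . $$ -/

import Mathlib

open MeasureTheory Set
open scoped ContDiff

noncomputable section

namespace KdVODE

/-- The Lebesgue space `L²(0,L)` of real-valued functions. -/
abbrev L2 (L : ℝ) : Type := Lp ℝ 2 (volume.restrict (Ioo (0 : ℝ) L))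

/-- `v` is the weak derivative of `u` on `(0,L)`: `∫ u φ' = - ∫ v φ` for every smooth `φ`
with compact support contained in `(0,L)`. -/
def HasWeakDeriv {L : ℝ} (u v : L2 L) : Prop :=
  ∀ φ : ℝ → ℝ, ContDiff ℝ ∞ φ → HasCompactSupport φ → tsupport φ ⊆ Ioo 0 L →
    ∫ x in Ioo 0 L, u x * deriv φ x = - ∫ x in Ioo 0 L, v x * φ x

lemma integrable_mul {L : ℝ} (u : L2 L) {φ : ℝ → ℝ} (hφ : Continuous φ) :
    IntegrableOn (fun x => u x * φ x) (Ioo 0 L) := by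
  have hu : Integrable (fun x => u x) (volume.restrict (Ioo (0 : ℝ) L)) :=
    (Lp.memLp u).integrable (by norm_num)
  obtain ⟨C, hC⟩ := (isCompact_Icc (a := (0 : ℝ)) (b := L)).exists_bound_of_continuousOn
    hφ.continuousOn
  refine hu.mul_bdd (c := C) hφ.aestronglyMeasurable ?_
  filter_upwards [ae_restrict_mem measurableSet_Ioo] with x hx
  exact hC x (Ioo_subset_Icc_self hx)

lemma integral_add_mul {L : ℝ} (u v : L2 L) {φ : ℝ → ℝ} (hφ : Continuous φ) :
    ∫ x in Ioo 0 L, (u + v : L2 L) x * φ x =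
      (∫ x in Ioo 0 L, u x * φ x) + ∫ x in Ioo 0 L, v x * φ x := by
  rw [← integral_add (integrable_mul u hφ) (integrable_mul v hφ)]
  refine integral_congr_ae ?_
  filter_upwards [Lp.coeFn_add u v] with x hx
  rw [hx, Pi.add_apply, add_mul]

lemma integral_smul_mul {L : ℝ} (r : ℝ) (u : L2 L) (φ : ℝ → ℝ) :
    ∫ x in Ioo 0 L, (r • u : L2 L) x * φ x = r * ∫ x in Ioo 0 L, u x * φ x := by
  rw [← integral_const_mul]
  refine integral_congr_ae ?_
  filter_upwards [Lp.coeFn_smul r u] with x hx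
  rw [hx, Pi.smul_apply, smul_eq_mul, mul_assoc]

lemma HasWeakDeriv.add {L : ℝ} {u v u' v' : L2 L} (h : HasWeakDeriv u v)
    (h' : HasWeakDeriv u' v') : HasWeakDeriv (u + u') (v + v') := by
  intro φ hφ hc hs
  rw [integral_add_mul u u' (hφ.continuous_deriv (by simp)),
    integral_add_mul v v' hφ.continuous, h φ hφ hc hs, h' φ hφ hc hs]
  ring

lemma HasWeakDeriv.smul {L : ℝ} {u v : L2 L} (r : ℝ) (h : HasWeakDeriv u v) :
    HasWeakDeriv (r • u) (r • v) := by
  intro φ hφ hc hs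
  rw [integral_smul_mul, integral_smul_mul, h φ hφ hc hs]
  ring

lemma HasWeakDeriv.zero {L : ℝ} : HasWeakDeriv (0 : L2 L) 0 := by
  intro φ hφ hc hs
  have h := fun ψ : ℝ → ℝ => integral_smul_mul (0 : ℝ) (0 : L2 L) ψ
  simp only [zero_mul, smul_zero] at h
  rw [h, h, neg_zero]

/-- The Sobolev space `H³(0,L)`. An element is a function `u ∈ L²(0,L)` listed together with its
weak derivatives `u', u'', u''' ∈ L²(0,L)` (which `u` determines), so that the inherited norm is
the usual one, `‖u‖² = ‖u‖²_{L²} + ‖u'‖²_{L²} + ‖u''‖²_{L²} + ‖u'''‖²_{L²}`. -/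
def H3 (L : ℝ) : Submodule ℝ (PiLp 2 (fun _ : Fin 4 => L2 L)) where
  carrier := {u | HasWeakDeriv (u 0) (u 1) ∧ HasWeakDeriv (u 1) (u 2) ∧ HasWeakDeriv (u 2) (u 3)}
  add_mem' := fun h h' => ⟨h.1.add h'.1, h.2.1.add h'.2.1, h.2.2.add h'.2.2⟩
  zero_mem' := ⟨HasWeakDeriv.zero, HasWeakDeriv.zero, HasWeakDeriv.zero⟩
  smul_mem' := fun r _ h => ⟨h.1.smul r, h.2.1.smul r, h.2.2.smul r⟩

/-- The derivative of order `k ≤ 3` of `u ∈ H³(0,L)`, as an element of `L²(0,L)`;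
`D 0 u` is `u` itself. -/
def D {L : ℝ} (k : Fin 4) (u : H3 L) : L2 L := u.1 k

open Classical in
/-- The value at `x ∈ [0,L]` of the continuous representative on `[0,L]` of `u`. (It exists
whenever `u` has a weak derivative in `L²(0,L)`; the default value `0` is used otherwise.) -/
def trace {L : ℝ} (u : L2 L) (x : ℝ) : ℝ :=
  if h : ∃ f : ℝ → ℝ, ContinuousOn f (Icc 0 L) ∧ u =ᵐ[volume.restrict (Ioo 0 L)] f
  then h.choose x else 0

/-- The trace does not depend on the choice of the continuous representative. -/
lemma trace_eq {L : ℝ} (hL : 0 < L) {u : L2 L} {f : ℝ → ℝ} (hf : ContinuousOn f (Icc 0 L))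
    (hu : u =ᵐ[volume.restrict (Ioo 0 L)] f) {x : ℝ} (hx : x ∈ Icc 0 L) : trace u x = f x := by
  have h : ∃ f : ℝ → ℝ, ContinuousOn f (Icc 0 L) ∧ u =ᵐ[volume.restrict (Ioo 0 L)] f := ⟨f, hf, hu⟩
  rw [trace, dif_pos h]
  have hae : h.choose =ᵐ[volume.restrict (Icc 0 L)] f := by
    rw [← Measure.restrict_congr_set Ioo_ae_eq_Icc]
    exact h.choose_spec.2.symm.trans hu
  exact Measure.eqOn_Icc_of_ae_eq volume hL.ne hae h.choose_spec.1 hf hx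

/-- `(y,z)` is a strong solution on `[0,∞)` of
`y_t + y_x + y_xxx = 0`, `y(t,0) = y(t,L) = 0`, `y_x(t,L) = a z(t)`, `z' = b z + c y_x(t,0)`,
with `y(0) = y₀`, `z(0) = z₀`, in the class
`y ∈ C(ℝ₊; H³(0,L)) ∩ C¹(ℝ₊; L²(0,L))`, `z ∈ C¹(ℝ₊)`. Only times `t ≥ 0` matter. -/
structure IsStrongSolution {L : ℝ} (a b c : ℝ) (y₀ : H3 L) (z₀ : ℝ)
    (y : ℝ → H3 L) (z : ℝ → ℝ) : Prop where
  continuousOn_H3 : ContinuousOn y (Ici 0)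
  contDiffOn_L2 : ContDiffOn ℝ 1 (fun t => D 0 (y t)) (Ici 0)
  contDiffOn_z : ContDiffOn ℝ 1 z (Ici 0)
  kdv : ∀ t ∈ Ici (0 : ℝ),
    derivWithin (fun s => D 0 (y s)) (Ici 0) t + D 1 (y t) + D 3 (y t) = 0
  left_end : ∀ t ∈ Ici (0 : ℝ), trace (D 0 (y t)) 0 = 0
  right_end : ∀ t ∈ Ici (0 : ℝ), trace (D 0 (y t)) L = 0
  right_slope : ∀ t ∈ Ici (0 : ℝ), trace (D 1 (y t)) L = a * z t
  ode : ∀ t ∈ Ici (0 : ℝ), derivWithin z (Ici 0) t = b * z t + c * trace (D 1 (y t)) 0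
  initial_y : y 0 = y₀
  initial_z : z 0 = z₀

/-- `(y,z)`, with `y ∈ C(ℝ₊; L²(0,L))` and `z ∈ C(ℝ₊)`, is a weak solution on `[0,∞)` of the same
system. The equations are tested with pairs `(φ,q)`, where `φ` is smooth on `[0,L]`, `q` is real,
`φ(0) = φ(L) = 0` and `φ'(0) = c q`: multiplying the first equation by `φ` and the last by `q`,
integrating over `(0,L)` and by parts, the boundary terms at `x = 0` that carry the undefined
trace `y_x(t,0)` cancel, and
`d/dt (∫ y φ + z q) = ∫ y (φ' + φ''') + z (b q + a φ'(L))`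
is left, which is imposed in integrated form. -/
structure IsWeakSolution {L : ℝ} (a b c : ℝ) (y₀ : L2 L) (z₀ : ℝ)
    (y : ℝ → L2 L) (z : ℝ → ℝ) : Prop where
  continuousOn_L2 : ContinuousOn y (Ici 0)
  continuousOn_z : ContinuousOn z (Ici 0)
  initial_y : y 0 = y₀
  initial_z : z 0 = z₀
  weak : ∀ (φ : ℝ → ℝ) (q : ℝ), ContDiff ℝ ∞ φ → φ 0 = 0 → φ L = 0 → deriv φ 0 = c * q →
    ∀ t ∈ Ici (0 : ℝ),
      (∫ x in Ioo 0 L, y t x * φ x) + z t * q =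
        (∫ x in Ioo 0 L, y₀ x * φ x) + z₀ * q +
          ∫ s in (0 : ℝ)..t,
            ((∫ x in Ioo 0 L, y s x * (deriv φ x + iteratedDeriv 3 φ x)) +
              z s * (b * q + a * deriv φ L))

end KdVODE

end

/-! On the Hilbert space `L²(0,L) × ℝ` the system reads `u' = A u` with `A (y, z) = (-y' - y''', b z
+ c y'(0))` and domain `y(0) = y(L) = 0`, `y'(L) = a z`. Integration by parts gives `⟪A u, u⟫ =
(y'(L)² - y'(0)²)/2 + (b z + c y'(0)) z`. Since `y'(L) = a z`, and since `c y'(0) z` is absorbed by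
`-y'(0)²/2`, this is at most `(a²/2 + b + c²/2) z²`. With `κ` the positive part of that constant, `A
- κ` is dissipative.

The range condition, solvability of `l u - A u = x` for `l > κ`, is a boundary value problem for a
third-order ODE (`exists_boundary_value_problem`). By variation of constants it becomes a square
linear system for the initial data and `z`. The energy estimate makes that system injective, hence
solvable. So `A - κ` is m-dissipative (`isMDissipative`), and Yosida approximations produce its
contraction semigroup `S`.

The solutions are `exp (κ t) S(t) u₀`. For `u₀` in the domain they equal a resolvent applied to a
continuous curve. The resolvent is bounded into `H³ × ℝ` by the closed graph theorem, whence
continuity in `H³` (`exists_classical_solution`, `continuous_resolvent`); uniqueness is the energy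
estimate. For general `u₀` the weak identity follows by density (`IsMDissipative.inner_semigroup`).

Weak uniqueness (`IsMDissipative.eq_zero_of_weak`) integrates the difference `w` of two solutions in
time. The primitive `W` satisfies `⟪w, ψ⟫ = ⟪W, A* ψ⟫` for all test pairs `ψ`. The adjoint boundary
value problem is the original one after the reflection `x ↦ L - x`, so `(1 + κ - A*) ψ` ranges over
all smooth data. This forces `W` into the domain with `A W = w = W'`; the energy estimate yields `W
= 0`, and then `w = A W = 0`. -/

noncomputable section

namespace KdVODE

open Filter Topology

/-! ### Contraction semigroups of m-dissipative operators on a Hilbert space, by Yosida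
approximation. -/

section Semigroup

variable {X E : Type*} [NormedAddCommGroup X] [InnerProductSpace ℝ X]
  [AddCommGroup E] [Module ℝ E]

/-- An operator `A` on `X`, given as a linear map on its domain `E`, which is embedded in `X`
by `ι`, is m-dissipative. -/
structure IsMDissipative (ι A : E →ₗ[ℝ] X) : Prop where
  injective : Function.Injective ι
  dissipative : ∀ e, inner ℝ (A e) (ι e) ≤ 0
  surjective : ∀ l : ℝ, 0 < l → ∀ x, ∃ e, l • ι e - A e = x

namespace IsMDissipative

variable {ι A : E →ₗ[ℝ] X}

/-- Dissipativity gives `l ‖ι e‖² ≤ ⟪l ι e - A e, ι e⟫`; conclude by Cauchy-Schwarz. -/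
lemma norm_le (h : IsMDissipative ι A) {l : ℝ} (hl : 0 < l) (e : E) :
    ‖ι e‖ ≤ l⁻¹ * ‖l • ι e - A e‖ := by
  have h1 : l * (‖ι e‖ * ‖ι e‖) ≤ ‖l • ι e - A e‖ * ‖ι e‖ := by
    have h2 := real_inner_le_norm (l • ι e - A e) (ι e)
    rw [inner_sub_left, real_inner_smul_left, real_inner_self_eq_norm_mul_norm] at h2
    linarith [h.dissipative e]
  rw [inv_mul_eq_div, le_div_iff₀ hl]
  rcases (norm_nonneg (ι e)).eq_or_lt with h0 | h0
  · rw [← h0]; simp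
  · exact le_of_mul_le_mul_right (by linarith) h0

lemma bijective (h : IsMDissipative ι A) {l : ℝ} (hl : 0 < l) :
    Function.Bijective (l • ι - A) := by
  refine ⟨(injective_iff_map_eq_zero _).2 fun e he => h.injective ?_, h.surjective l hl⟩
  have := h.norm_le hl e
  rw [show l • ι e - A e = 0 from he] at this
  rw [map_zero]
  simpa using this

open Classical in
/-- The resolvent `(l - A)⁻¹`, with values in the domain of `A`. -/
def resolvent (h : IsMDissipative ι A) (l : ℝ) : X →ₗ[ℝ] E :=
  if hl : 0 < l then (LinearEquiv.ofBijective (l • ι - A) (h.bijective hl)).symm else 0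

lemma resolvent_sub (h : IsMDissipative ι A) {l : ℝ} (hl : 0 < l) (e : E) :
    h.resolvent l (l • ι e - A e) = e := by
  rw [resolvent, dif_pos hl]
  exact (LinearEquiv.ofBijective (l • ι - A) (h.bijective hl)).symm_apply_apply e

lemma sub_resolvent (h : IsMDissipative ι A) {l : ℝ} (hl : 0 < l) (x : X) :
    l • ι (h.resolvent l x) - A (h.resolvent l x) = x := by
  rw [resolvent, dif_pos hl]
  exact (LinearEquiv.ofBijective (l • ι - A) (h.bijective hl)).apply_symm_apply x

/-- The resolvent `(l - A)⁻¹`, as a bounded operator. -/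
def resolventL (h : IsMDissipative ι A) (l : ℝ) : X →L[ℝ] X :=
  (ι ∘ₗ h.resolvent l).mkContinuous |l|⁻¹ fun x => by
    by_cases hl : 0 < l
    · have := h.norm_le hl (h.resolvent l x)
      rw [h.sub_resolvent hl] at this
      rwa [abs_of_pos hl]
    · simp only [resolvent, dif_neg hl, LinearMap.comp_zero, LinearMap.zero_apply, norm_zero]
      positivity

lemma resolventL_apply (h : IsMDissipative ι A) (l : ℝ) (x : X) :
    h.resolventL l x = ι (h.resolvent l x) := rfl

lemma norm_resolventL_le (h : IsMDissipative ι A) {l : ℝ} (hl : 0 < l) (x : X) :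
    ‖h.resolventL l x‖ ≤ l⁻¹ * ‖x‖ := by
  have := h.norm_le hl (h.resolvent l x)
  rwa [h.sub_resolvent hl] at this

/-- Write `x = (l - A) R x + (m - l) R x` with `R` the resolvent at `m`, and apply the resolvent at
`l`. -/
lemma resolvent_identity (h : IsMDissipative ι A) {l m : ℝ} (hl : 0 < l) (hm : 0 < m) (x : X) :
    h.resolventL l x = (m - l) • h.resolventL l (h.resolventL m x) + h.resolventL m x := by
  have h1 : x = (m - l) • h.resolventL m x + (l • ι (h.resolvent m x) - A (h.resolvent m x)) := by
    conv_lhs => rw [← h.sub_resolvent hm x]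
    rw [resolventL_apply, sub_smul]; abel
  conv_lhs => rw [h1]
  rw [map_add, map_smul, h.resolventL_apply l (_ - _), h.resolvent_sub hl, ← resolventL_apply]

lemma commute_resolventL (h : IsMDissipative ι A) {l m : ℝ} (hl : 0 < l) (hm : 0 < m) :
    Commute (h.resolventL l) (h.resolventL m) := by
  ext x
  rcases eq_or_ne l m with rfl | hne
  · rfl
  have h1 := h.resolvent_identity hl hm x
  have h2 := h.resolvent_identity hm hl x
  have h3 : (m - l) • h.resolventL l (h.resolventL m x) =
      (m - l) • h.resolventL m (h.resolventL l x) := by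
    rw [← sub_eq_iff_eq_add] at h1 h2
    rw [← h1, ← neg_sub l m, neg_smul, ← h2, neg_sub]
  exact smul_right_injective X (sub_ne_zero.2 hne.symm) h3

/-- The Yosida approximation `l A (l - A)⁻¹ = l (l (l - A)⁻¹ - 1)` of `A`. -/
def yosida (h : IsMDissipative ι A) (l : ℝ) : X →L[ℝ] X :=
  l • (l • h.resolventL l - 1)

lemma yosida_apply (h : IsMDissipative ι A) {l : ℝ} (hl : 0 < l) (x : X) :
    h.yosida l x = l • A (h.resolvent l x) := by
  have h1 : h.yosida l x = l • (l • ι (h.resolvent l x) - x) := rfl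
  rw [h1]
  nth_rw 2 [← h.sub_resolvent hl x]
  rw [sub_sub_cancel]

/-- With `e = (l - A)⁻¹ x` and `x = l ι e - A e`, the inner product is `l (l ⟪A e, ι e⟫ - ‖A e‖²)`.
-/
lemma yosida_dissipative (h : IsMDissipative ι A) {l : ℝ} (hl : 0 < l) (x : X) :
    inner ℝ (h.yosida l x) x ≤ 0 := by
  rw [h.yosida_apply hl]
  nth_rw 2 [← h.sub_resolvent hl x]
  rw [real_inner_smul_left, inner_sub_right, real_inner_smul_right]
  have h1 := h.dissipative (h.resolvent l x)
  have h2 := real_inner_self_nonneg (x := A (h.resolvent l x))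
  have h3 := mul_nonpos_of_nonneg_of_nonpos hl.le h1
  exact mul_nonpos_of_nonneg_of_nonpos hl.le (by linarith)

lemma commute_yosida_resolventL (h : IsMDissipative ι A) {l m : ℝ} (hl : 0 < l) (hm : 0 < m) :
    Commute (h.yosida l) (h.resolventL m) :=
  (((h.commute_resolventL hl hm).smul_left l).sub_left (Commute.one_left _)).smul_left l

lemma commute_yosida (h : IsMDissipative ι A) {l m : ℝ} (hl : 0 < l) (hm : 0 < m) :
    Commute (h.yosida l) (h.yosida m) :=
  (((h.commute_yosida_resolventL hl hm).smul_right m).sub_right (Commute.one_right _)).smul_right m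

lemma yosida_eq (h : IsMDissipative ι A) {l : ℝ} (hl : 0 < l) (e : E) :
    h.yosida l (ι e) = l • h.resolventL l (A e) := by
  have h1 : h.yosida l (ι e) = l • (l • h.resolventL l (ι e) - ι e) := rfl
  have h2 := congrArg ι (h.resolvent_sub hl e)
  rw [map_sub, map_smul, map_sub, map_smul, ← resolventL_apply, ← resolventL_apply] at h2
  rw [h1]
  nth_rw 2 [← h2]
  rw [sub_sub_cancel]

lemma norm_yosida_le (h : IsMDissipative ι A) {l : ℝ} (hl : 0 < l) (e : E) :
    ‖h.yosida l (ι e)‖ ≤ ‖A e‖ := by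
  rw [h.yosida_eq hl, norm_smul, Real.norm_of_nonneg hl.le]
  have := h.norm_resolventL_le hl (A e)
  calc l * _ ≤ l * (l⁻¹ * ‖A e‖) := by gcongr
    _ = ‖A e‖ := by field_simp

/-- The domain of an m-dissipative operator is dense. -/
lemma denseRange [CompleteSpace X] (h : IsMDissipative ι A) : DenseRange ι := by
  have h1 : (LinearMap.range ι).topologicalClosure = ⊤ := by
    rw [Submodule.topologicalClosure_eq_top_iff, Submodule.eq_bot_iff]
    intro v hv
    -- For `v` orthogonal to the domain, solve `ι e - A e = v`. Then `0 = ⟪ι e, v⟫ ≥ ‖ι e‖²`.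
    obtain ⟨e, he⟩ := h.surjective 1 one_pos v
    have h2 : inner ℝ (ι e) v = 0 := hv (ι e) ⟨e, rfl⟩
    rw [← he, inner_sub_right, real_inner_smul_right, real_inner_self_eq_norm_mul_norm,
      real_inner_comm] at h2
    have h3 := h.dissipative e
    have h4 : ‖ι e‖ * ‖ι e‖ = 0 := le_antisymm (by linarith) (by positivity)
    have h5 : e = 0 := h.injective (by simpa using h4)
    rw [← he, h5]; simp
  have := Submodule.dense_iff_topologicalClosure_eq_top.2 h1
  rwa [LinearMap.coe_range] at this

lemma tendsto_yosida [CompleteSpace X] (h : IsMDissipative ι A) (e : E) :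
    Tendsto (fun n : ℕ => h.yosida (n + 1) (ι e)) atTop (𝓝 (A e)) := by
  have hpos : ∀ n : ℕ, (0 : ℝ) < n + 1 := fun n => by positivity
  -- For `x = ι e` the error is the resolvent at `n + 1` applied to `A e`, which is `O(1/n)`.
  -- Density and the uniform bound extend this to every `x`.
  have key : ∀ x, Tendsto (fun n : ℕ => ((n : ℝ) + 1) • h.resolventL (n + 1) x) atTop (𝓝 x) := by
    intro x
    rw [Metric.tendsto_atTop]
    intro ε hε
    obtain ⟨e, he⟩ := Metric.denseRange_iff.1 h.denseRange x (ε / 3) (by positivity)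
    rw [dist_eq_norm] at he
    obtain ⟨N, hN⟩ := exists_nat_gt (‖A e‖ / (ε / 3))
    refine ⟨N, fun n hn => ?_⟩
    have hn0 := hpos n
    have h1 : ((n : ℝ) + 1) • h.resolventL (n + 1) (ι e) - ι e = h.resolventL (n + 1) (A e) := by
      have := h.yosida_eq hn0 e
      exact smul_right_injective X hn0.ne' this
    have h2 := h.norm_resolventL_le hn0 (x - ι e)
    have h3 := h.norm_resolventL_le hn0 (A e)
    have h4 : ((n : ℝ) + 1)⁻¹ * ‖A e‖ < ε / 3 := by
      rw [div_lt_iff₀ (by positivity)] at hN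
      rw [inv_mul_lt_iff₀ hn0]
      have : (N : ℝ) ≤ n := by exact_mod_cast hn
      nlinarith
    have h5 : ((n : ℝ) + 1) • h.resolventL (n + 1) x - x =
        ((n : ℝ) + 1) • h.resolventL (n + 1) (x - ι e) + h.resolventL (n + 1) (A e) - (x - ι e) := by
      rw [← h1, map_sub, smul_sub]; abel
    have h6 : ‖((n : ℝ) + 1) • h.resolventL (n + 1) (x - ι e)‖ ≤ ‖x - ι e‖ := by
      rw [norm_smul, Real.norm_of_nonneg hn0.le]
      calc ((n : ℝ) + 1) * _ ≤ (n + 1) * (((n : ℝ) + 1)⁻¹ * ‖x - ι e‖) := by gcongr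
        _ = _ := by field_simp
    rw [dist_eq_norm, h5]
    have h7 := norm_sub_le (((n : ℝ) + 1) • h.resolventL (n + 1) (x - ι e) +
      h.resolventL (n + 1) (A e)) (x - ι e)
    have h8 := norm_add_le (((n : ℝ) + 1) • h.resolventL (n + 1) (x - ι e))
      (h.resolventL (n + 1) (A e))
    linarith
  exact (key (A e)).congr fun n => (h.yosida_eq (hpos n) e).symm

end IsMDissipative

/-- A function with `⟪u', u⟫ ≤ κ ‖u‖²` grows at most like `exp (κ t)`. -/
lemma norm_le_of_inner_deriv_le {u u' : ℝ → X} {κ : ℝ}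
    (hu : ∀ t ∈ Ici (0 : ℝ), HasDerivWithinAt u (u' t) (Ici 0) t)
    (hd : ∀ t ∈ Ici (0 : ℝ), inner ℝ (u' t) (u t) ≤ κ * ‖u t‖ ^ 2) {t : ℝ} (ht : 0 ≤ t) :
    ‖u t‖ ≤ Real.exp (κ * t) * ‖u 0‖ := by
  have h1 : ∀ s ∈ Ici (0 : ℝ), HasDerivWithinAt (fun s => Real.exp (-(2 * κ * s)) * ‖u s‖ ^ 2)
      (Real.exp (-(2 * κ * s)) * (2 * (inner ℝ (u' s) (u s) - κ * ‖u s‖ ^ 2))) (Ici 0) s := by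
    intro s hs
    have h2 : HasDerivAt (fun s : ℝ => Real.exp (-(2 * κ * s)))
        (Real.exp (-(2 * κ * s)) * -(2 * κ * 1)) s :=
      (((hasDerivAt_id s).const_mul (2 * κ)).neg).exp
    have h3 := h2.hasDerivWithinAt.mul (hu s hs).norm_sq
    refine h3.congr_deriv ?_
    rw [real_inner_comm]
    ring
  have h4 : AntitoneOn (fun s => Real.exp (-(2 * κ * s)) * ‖u s‖ ^ 2) (Ici 0) := by
    refine antitoneOn_of_hasDerivWithinAt_nonpos (convex_Ici 0)
      (fun s hs => (h1 s hs).continuousWithinAt)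
      (fun s hs => (h1 s (interior_subset hs)).mono interior_subset) fun s hs => ?_
    have := hd s (interior_subset hs)
    exact mul_nonpos_of_nonneg_of_nonpos (Real.exp_pos _).le (by linarith)
  have h5 := h4 self_mem_Ici (mem_Ici.2 ht) ht
  simp only [mul_zero, neg_zero, Real.exp_zero, one_mul] at h5
  refine abs_le_of_sq_le_sq' ?_ (by positivity) |>.2
  rw [mul_pow, ← Real.exp_nat_mul]
  have h6 : Real.exp (((2 : ℕ) : ℝ) * (κ * t)) * Real.exp (-(2 * κ * t)) = 1 := by
    rw [← Real.exp_add]; simp; ring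
  calc ‖u t‖ ^ 2 = Real.exp (((2 : ℕ) : ℝ) * (κ * t)) * (Real.exp (-(2 * κ * t)) * ‖u t‖ ^ 2) := by
        rw [← mul_assoc, h6, one_mul]
    _ ≤ _ := by gcongr

variable [CompleteSpace X]

lemma hasDerivAt_exp_apply (B : X →L[ℝ] X) (x : X) (t : ℝ) :
    HasDerivAt (fun s : ℝ => NormedSpace.exp (s • B) x) (NormedSpace.exp (t • B) (B x)) t := by
  have h1 := hasDerivAt_exp_smul_const (𝕂 := ℝ) B t
  simpa using h1.clm_apply (hasDerivAt_const t x)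

lemma hasDerivAt_exp_apply' (B : X →L[ℝ] X) (x : X) (t : ℝ) :
    HasDerivAt (fun s : ℝ => NormedSpace.exp (s • B) x) (B (NormedSpace.exp (t • B) x)) t := by
  have h1 := hasDerivAt_exp_smul_const' (𝕂 := ℝ) B t
  simpa using h1.clm_apply (hasDerivAt_const t x)

lemma norm_exp_apply_le {B : X →L[ℝ] X} (hB : ∀ x, inner ℝ (B x) x ≤ 0) {t : ℝ} (ht : 0 ≤ t)
    (x : X) : ‖NormedSpace.exp (t • B) x‖ ≤ ‖x‖ := by
  have := norm_le_of_inner_deriv_le (u := fun s : ℝ => NormedSpace.exp (s • B) x) (κ := 0)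
    (fun s _ => (hasDerivAt_exp_apply' B x s).hasDerivWithinAt)
    (fun s _ => by rw [zero_mul]; exact hB _) ht
  simpa using this

/-- The path `s ↦ exp (s B) exp ((t - s) C) x` joins the two vectors. As `B` and `C` commute, its
derivative is a contraction applied to `B x - C x`. -/
lemma norm_exp_sub_exp_le {B C : X →L[ℝ] X} (hB : ∀ x, inner ℝ (B x) x ≤ 0)
    (hC : ∀ x, inner ℝ (C x) x ≤ 0) (hBC : Commute B C) {t : ℝ} (ht : 0 ≤ t) (x : X) :
    ‖NormedSpace.exp (t • B) x - NormedSpace.exp (t • C) x‖ ≤ t * ‖B x - C x‖ := by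
  let f : ℝ → X := fun s => NormedSpace.exp (s • B) (NormedSpace.exp ((t - s) • C) x)
  have hf : ∀ s, HasDerivAt f
      (NormedSpace.exp (s • B) (NormedSpace.exp ((t - s) • C) (B x - C x))) s := by
    intro s
    have h1 := hasDerivAt_exp_smul_const (𝕂 := ℝ) B s
    have h2 : HasDerivAt (fun s => NormedSpace.exp ((t - s) • C) x)
        (-(NormedSpace.exp ((t - s) • C) (C x))) s := by
      have := (hasDerivAt_exp_apply C x (t - s)).scomp s ((hasDerivAt_id s).const_sub t)
      rwa [neg_one_smul] at this
    convert h1.clm_apply h2 using 1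
    have h3 : Commute B (NormedSpace.exp ((t - s) • C)) := (hBC.smul_right (t - s)).exp_right
    have h4 := DFunLike.congr_fun h3.eq x
    change B (NormedSpace.exp ((t - s) • C) x) = NormedSpace.exp ((t - s) • C) (B x) at h4
    change _ = NormedSpace.exp (s • B) (B (NormedSpace.exp ((t - s) • C) x)) + _
    rw [h4, map_sub, map_sub, map_neg]; abel
  have h1 := norm_image_sub_le_of_norm_deriv_le_segment' (f := f) (a := 0) (b := t)
    (C := ‖B x - C x‖) (fun s _ => (hf s).hasDerivWithinAt) (fun s hs =>
      (norm_exp_apply_le hB hs.1 _).trans (norm_exp_apply_le hC (sub_nonneg.2 hs.2.le) _))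
      t (right_mem_Icc.2 ht)
  simp only [f, sub_self, zero_smul, NormedSpace.exp_zero, sub_zero] at h1
  simpa [mul_comm] using h1

/-- The fundamental theorem of calculus on `[0,∞)`. -/
lemma hasDerivWithinAt_integral_Ici {V : Type*} [NormedAddCommGroup V] [NormedSpace ℝ V]
    [CompleteSpace V] {w : ℝ → V} (hw : ContinuousOn w (Ici 0)) {t : ℝ} (ht : t ∈ Ici (0 : ℝ)) :
    HasDerivWithinAt (fun s => ∫ r in (0 : ℝ)..s, w r) (w t) (Ici 0) t := by
  -- Freezing `w` at its initial value for negative times makes the integrand continuous on all of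
  -- `ℝ`.
  let g : ℝ → V := fun s => w (max s 0)
  have hg : Continuous g :=
    hw.comp_continuous (by fun_prop) fun s => mem_Ici.2 (le_max_right _ _)
  have h1 : HasDerivAt (fun s => ∫ r in (0 : ℝ)..s, g r) (g t) t :=
    intervalIntegral.integral_hasDerivAt_right (hg.intervalIntegrable _ _)
      (hg.stronglyMeasurableAtFilter _ _) hg.continuousAt
  have h2 : ∀ r ∈ Ici (0 : ℝ), w r = g r := fun r hr => by simp only [g, max_eq_left (mem_Ici.1 hr)]
  have h3 : ∀ s ∈ Ici (0 : ℝ), ∫ r in (0 : ℝ)..s, w r = ∫ r in (0 : ℝ)..s, g r := fun s hs =>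
    intervalIntegral.integral_congr fun r hr => h2 r (by rw [uIcc_of_le hs] at hr; exact hr.1)
  rw [h2 t ht]
  exact h1.hasDerivWithinAt.congr h3 (h3 t ht)

namespace IsMDissipative

variable {ι A : E →ₗ[ℝ] X}

/-- On the domain, `norm_exp_sub_exp_le` bounds the difference of two approximations by that of
their Yosida generators, which converge. Contractivity and density give the Cauchy property
everywhere. -/
lemma exists_tendsto (h : IsMDissipative ι A) {t : ℝ} (ht : 0 ≤ t) (x : X) :
    ∃ y, Tendsto (fun n : ℕ => NormedSpace.exp (t • h.yosida (n + 1)) x) atTop (𝓝 y) := by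
  have hpos : ∀ n : ℕ, (0 : ℝ) < n + 1 := fun n => by positivity
  apply cauchySeq_tendsto_of_complete
  rw [Metric.cauchySeq_iff']
  intro ε hε
  obtain ⟨e, he⟩ := Metric.denseRange_iff.1 h.denseRange x (ε / 4) (by positivity)
  rw [dist_eq_norm] at he
  obtain ⟨N, hN⟩ := Metric.cauchySeq_iff'.1 (h.tendsto_yosida e).cauchySeq (ε / (4 * (t + 1)))
    (by positivity)
  refine ⟨N, fun n hn => ?_⟩
  have h1 := hN n hn
  rw [dist_eq_norm, lt_div_iff₀ (by positivity)] at h1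
  have h2 := norm_exp_sub_exp_le (h.yosida_dissipative (hpos n)) (h.yosida_dissipative (hpos N))
    (h.commute_yosida (hpos n) (hpos N)) ht (ι e)
  have h3 := norm_exp_apply_le (h.yosida_dissipative (hpos n)) ht (x - ι e)
  have h4 := norm_exp_apply_le (h.yosida_dissipative (hpos N)) ht (x - ι e)
  rw [map_sub] at h3 h4
  rw [dist_eq_norm]
  generalize NormedSpace.exp (t • h.yosida (n + 1)) = P at *
  generalize NormedSpace.exp (t • h.yosida (N + 1)) = Q at *
  have h5 : P x - Q x = (P x - P (ι e)) + (P (ι e) - Q (ι e)) - (Q x - Q (ι e)) := by abel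
  rw [h5]
  have h6 := norm_sub_le ((P x - P (ι e)) + (P (ι e) - Q (ι e))) (Q x - Q (ι e))
  have h7 := norm_add_le (P x - P (ι e)) (P (ι e) - Q (ι e))
  have h8 : 0 ≤ ‖(h.yosida (n + 1)) (ι e) - (h.yosida (N + 1)) (ι e)‖ := norm_nonneg _
  nlinarith

open Classical in
/-- The contraction semigroup generated by `A`, as the limit of those generated by the Yosida
approximations. -/
def semigroup (h : IsMDissipative ι A) (t : ℝ) (x : X) : X :=
  if ht : 0 ≤ t then (h.exists_tendsto ht x).choose else 0

variable (h : IsMDissipative ι A)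

lemma tendsto_semigroup {t : ℝ} (ht : 0 ≤ t) (x : X) :
    Tendsto (fun n : ℕ => NormedSpace.exp (t • h.yosida (n + 1)) x) atTop
      (𝓝 (h.semigroup t x)) := by
  rw [semigroup, dif_pos ht]
  exact (h.exists_tendsto ht x).choose_spec

lemma semigroup_zero (x : X) : h.semigroup 0 x = x := by
  refine tendsto_nhds_unique (h.tendsto_semigroup le_rfl x) ?_
  simp

lemma semigroup_sub {t : ℝ} (ht : 0 ≤ t) (x y : X) :
    h.semigroup t (x - y) = h.semigroup t x - h.semigroup t y := by
  refine tendsto_nhds_unique (h.tendsto_semigroup ht _) ?_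
  simpa using (h.tendsto_semigroup ht x).sub (h.tendsto_semigroup ht y)

lemma norm_semigroup_le {t : ℝ} (ht : 0 ≤ t) (x : X) : ‖h.semigroup t x‖ ≤ ‖x‖ :=
  le_of_tendsto (h.tendsto_semigroup ht x).norm
    (Eventually.of_forall fun n => norm_exp_apply_le (h.yosida_dissipative (by positivity)) ht x)

lemma semigroup_resolventL {t l : ℝ} (ht : 0 ≤ t) (hl : 0 < l) (x : X) :
    h.semigroup t (h.resolventL l x) = h.resolventL l (h.semigroup t x) := by
  refine tendsto_nhds_unique (h.tendsto_semigroup ht _) ?_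
  refine (((h.resolventL l).continuous.tendsto _).comp (h.tendsto_semigroup ht x)).congr fun n => ?_
  have h1 : Commute (h.resolventL l) (NormedSpace.exp (t • h.yosida (n + 1))) :=
    ((h.commute_yosida_resolventL (by positivity) hl).symm.smul_right t).exp_right
  exact DFunLike.congr_fun h1.eq x

lemma norm_semigroup_sub_le {s t : ℝ} (hs : 0 ≤ s) (ht : s ≤ t) (e : E) :
    ‖h.semigroup t (ι e) - h.semigroup s (ι e)‖ ≤ ‖A e‖ * (t - s) := by
  refine le_of_tendsto ((h.tendsto_semigroup (hs.trans ht) (ι e)).sub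
    (h.tendsto_semigroup hs (ι e))).norm (Eventually.of_forall fun n => ?_)
  have hn : (0 : ℝ) < n + 1 := by positivity
  exact norm_image_sub_le_of_norm_deriv_le_segment'
    (f := fun s : ℝ => NormedSpace.exp (s • h.yosida (n + 1)) (ι e)) (a := s) (b := t)
    (fun r _ => (hasDerivAt_exp_apply _ _ r).hasDerivWithinAt)
    (fun r hr => (norm_exp_apply_le (h.yosida_dissipative hn) (hs.trans hr.1) _).trans
      (h.norm_yosida_le hn e)) t (right_mem_Icc.2 ht)

lemma continuousOn_semigroup (x : X) : ContinuousOn (fun t => h.semigroup t x) (Ici 0) := by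
  rw [Metric.continuousOn_iff]
  intro t ht ε hε
  obtain ⟨e, he⟩ := Metric.denseRange_iff.1 h.denseRange x (ε / 4) (by positivity)
  rw [dist_eq_norm] at he
  refine ⟨ε / (4 * (‖A e‖ + 1)), by positivity, fun s hs hst => ?_⟩
  rw [lt_div_iff₀ (by positivity), Real.dist_eq] at hst
  have h1 : ‖h.semigroup s (ι e) - h.semigroup t (ι e)‖ ≤ ‖A e‖ * |s - t| := by
    rcases le_total s t with h2 | h2
    · rw [norm_sub_rev, abs_sub_comm, abs_of_nonneg (sub_nonneg.2 h2)]
      exact h.norm_semigroup_sub_le hs h2 e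
    · rw [abs_of_nonneg (sub_nonneg.2 h2)]
      exact h.norm_semigroup_sub_le ht h2 e
  have h3 := h.norm_semigroup_le hs (x - ι e)
  have h4 := h.norm_semigroup_le ht (x - ι e)
  rw [h.semigroup_sub hs] at h3
  rw [h.semigroup_sub ht] at h4
  rw [dist_eq_norm]
  have h5 : h.semigroup s x - h.semigroup t x = (h.semigroup s x - h.semigroup s (ι e)) +
    (h.semigroup s (ι e) - h.semigroup t (ι e)) - (h.semigroup t x - h.semigroup t (ι e)) := by abel
  rw [h5]
  have h6 := norm_sub_le ((h.semigroup s x - h.semigroup s (ι e)) +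
    (h.semigroup s (ι e) - h.semigroup t (ι e))) (h.semigroup t x - h.semigroup t (ι e))
  have h7 := norm_add_le (h.semigroup s x - h.semigroup s (ι e))
    (h.semigroup s (ι e) - h.semigroup t (ι e))
  have h8 : 0 ≤ |s - t| := abs_nonneg _
  have h9 := norm_nonneg (A e)
  nlinarith

/-- The integrated equation holds for each Yosida approximation. The integrands are dominated by `‖A
e‖`, so it passes to the limit. -/
lemma semigroup_eq_integral {t : ℝ} (ht : 0 ≤ t) (e : E) :
    h.semigroup t (ι e) = ι e + ∫ s in (0 : ℝ)..t, h.semigroup s (A e) := by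
  have hpos : ∀ n : ℕ, (0 : ℝ) < n + 1 := fun n => by positivity
  have hcont : ∀ (n : ℕ) x, Continuous
      (fun s : ℝ => NormedSpace.exp (s • h.yosida (n + 1)) x) := fun n x =>
    continuous_iff_continuousAt.2 fun s => (hasDerivAt_exp_apply _ x s).continuousAt
  have h1 : Tendsto (fun n : ℕ => ι e + ∫ s in (0 : ℝ)..t,
      NormedSpace.exp (s • h.yosida (n + 1)) (h.yosida (n + 1) (ι e))) atTop
      (𝓝 (ι e + ∫ s in (0 : ℝ)..t, h.semigroup s (A e))) := by
    refine tendsto_const_nhds.add ?_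
    refine intervalIntegral.tendsto_integral_filter_of_dominated_convergence (fun _ => ‖A e‖)
      (Eventually.of_forall fun n => (hcont n _).aestronglyMeasurable)
      (Eventually.of_forall fun n => ae_of_all _ fun s hs => ?_)
      intervalIntegrable_const (ae_of_all _ fun s hs => ?_)
    · rw [uIoc_of_le ht] at hs
      exact (norm_exp_apply_le (h.yosida_dissipative (hpos n)) hs.1.le _).trans
        (h.norm_yosida_le (hpos n) e)
    · rw [uIoc_of_le ht] at hs
      have h2 : Tendsto (fun n : ℕ => NormedSpace.exp (s • h.yosida (n + 1))
          (h.yosida (n + 1) (ι e) - A e)) atTop (𝓝 0) := by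
        refine squeeze_zero_norm (fun n => norm_exp_apply_le (h.yosida_dissipative (hpos n))
          hs.1.le _) ?_
        have := ((h.tendsto_yosida e).sub_const (A e)).norm
        simpa using this
      have h3 := h2.add (h.tendsto_semigroup hs.1.le (A e))
      simpa using h3
  refine tendsto_nhds_unique (h.tendsto_semigroup ht _) (h1.congr fun n => ?_)
  rw [intervalIntegral.integral_eq_sub_of_hasDerivAt
    (fun s _ => hasDerivAt_exp_apply (h.yosida (n + 1)) (ι e) s)
    ((hcont n _).intervalIntegrable _ _)]
  simp

lemma hasDerivWithinAt_semigroup {t : ℝ} (ht : t ∈ Ici (0 : ℝ)) (e : E) :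
    HasDerivWithinAt (fun s => h.semigroup s (ι e)) (h.semigroup t (A e)) (Ici 0) t :=
  ((hasDerivWithinAt_integral_Ici (h.continuousOn_semigroup (A e)) ht).const_add (ι e)).congr
    (fun _ hs => h.semigroup_eq_integral hs e) (h.semigroup_eq_integral ht e)

lemma continuous_semigroup {t : ℝ} (ht : 0 ≤ t) : Continuous (h.semigroup t) := by
  refine (LipschitzWith.of_dist_le_mul (K := 1) fun x y => ?_).continuous
  rw [dist_eq_norm, dist_eq_norm, ← h.semigroup_sub ht, NNReal.coe_one, one_mul]
  exact h.norm_semigroup_le ht _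

end IsMDissipative

/-- The Cauchy problem for an operator `A` which is m-dissipative up to a multiple of `ι`. -/
lemma exists_classical_solution {ι A : E →ₗ[ℝ] X} {κ : ℝ} (h : IsMDissipative ι (A - κ • ι))
    (e₀ : E) : ∃ v : ℝ → X, ContinuousOn v (Ici 0) ∧
      (∀ t, A (h.resolvent 1 (v t)) = (1 + κ) • h.resolventL 1 (v t) - v t) ∧
      h.resolvent 1 (v 0) = e₀ ∧ ∀ t ∈ Ici (0 : ℝ),
      h.resolventL 1 (v t) = Real.exp (κ * t) • h.semigroup t (ι e₀) ∧
      HasDerivWithinAt (fun t => h.resolventL 1 (v t)) (A (h.resolvent 1 (v t))) (Ici 0) t := by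
  -- Evolving `x₀ = (1 + κ - A) e₀` and then applying the resolvent keeps the solution in the
  -- domain. Both `u` and `A u` are thereby controlled by a curve that is continuous in `X`.
  set x₀ := (1 : ℝ) • ι e₀ - (A - κ • ι) e₀ with hx₀
  have hR : h.resolvent 1 x₀ = e₀ := h.resolvent_sub one_pos e₀
  have hexp : Continuous fun t : ℝ => Real.exp (κ * t) := by fun_prop
  have hA : ∀ x, A (h.resolvent 1 x) = (1 + κ) • h.resolventL 1 x - x := fun x => by
    have h1 := h.sub_resolvent one_pos x
    rw [LinearMap.sub_apply, LinearMap.smul_apply, ← h.resolventL_apply] at h1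
    nth_rw 3 [← h1]
    rw [add_smul]; abel
  have hv : ∀ t ∈ Ici (0 : ℝ), h.resolventL 1 (Real.exp (κ * t) • h.semigroup t x₀) =
      Real.exp (κ * t) • h.semigroup t (ι e₀) := fun t ht => by
    rw [map_smul, ← h.semigroup_resolventL ht one_pos, h.resolventL_apply, hR]
  refine ⟨fun t => Real.exp (κ * t) • h.semigroup t x₀,
    hexp.continuousOn.smul (h.continuousOn_semigroup x₀), fun t => hA _, ?_, fun t ht => ⟨hv t ht, ?_⟩⟩
  · simp only [mul_zero, Real.exp_zero, one_smul, h.semigroup_zero, hR]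
  · have h1 : HasDerivAt (fun t : ℝ => Real.exp (κ * t)) (Real.exp (κ * t) * (κ * 1)) t :=
      ((hasDerivAt_id t).const_mul κ).exp
    refine ((h1.hasDerivWithinAt.smul (h.hasDerivWithinAt_semigroup ht e₀)).congr hv
      (hv t ht)).congr_deriv ?_
    have h2 : (A - κ • ι) e₀ = ι e₀ - x₀ := by rw [hx₀, one_smul, sub_sub_cancel]
    rw [hA, hv t ht, h2, h.semigroup_sub ht]
    module

end Semigroup

/-! ### Weak derivatives on an interval, continuous representatives, and Green's formula. -/

section Sobolev

/-- On `[0,L]`, the function `W` is a primitive of the integrable function `v`. -/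
def IsPrimitive (L : ℝ) (W v : ℝ → ℝ) : Prop :=
  IntervalIntegrable v volume 0 L ∧ ∀ x ∈ Icc 0 L, W x = W 0 + ∫ s in (0 : ℝ)..x, v s

variable {L : ℝ}

lemma isPrimitive_of_hasDerivAt {W v : ℝ → ℝ} (hW : ∀ x, HasDerivAt W (v x) x)
    (hv : Continuous v) : IsPrimitive L W v := by
  refine ⟨hv.intervalIntegrable _ _, fun x _ => ?_⟩
  rw [intervalIntegral.integral_eq_sub_of_hasDerivAt (fun s _ => hW s) (hv.intervalIntegrable _ _)]
  ring

lemma isPrimitive_integral (c : ℝ) {v : ℝ → ℝ} (hv : IntervalIntegrable v volume 0 L) :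
    IsPrimitive L (fun x => c + ∫ s in (0 : ℝ)..x, v s) v :=
  ⟨hv, fun x _ => by simp⟩

/-- Integration by parts for absolutely continuous functions. It must hold at this generality
because `y'''` is merely integrable. -/
lemma IsPrimitive.integral_eq (hL : 0 ≤ L) {W v V w : ℝ → ℝ} (hW : IsPrimitive L W v)
    (hV : IsPrimitive L V w) :
    ∫ x in (0 : ℝ)..L, (v x * V x + W x * w x) = W L * V L - W 0 * V 0 := by
  have hac : ∀ {c : ℝ} {v : ℝ → ℝ}, IntervalIntegrable v volume 0 L →
      AbsolutelyContinuousOnInterval (fun x => c + ∫ s in (0 : ℝ)..x, v s) 0 L := fun hv =>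
    (contDiffOn_const (n := 1)).absolutelyContinuousOnInterval.fun_add
      (hv.absolutelyContinuousOnInterval_intervalIntegral left_mem_uIcc)
  have h1 := (hac (c := W 0) hW.1).integral_deriv_mul_eq_sub (hac (c := V 0) hV.1)
  rw [← hW.2 L (right_mem_Icc.2 hL), ← hV.2 L (right_mem_Icc.2 hL)] at h1
  simp only [intervalIntegral.integral_same, add_zero] at h1
  rw [← h1]
  refine intervalIntegral.integral_congr_ae ?_
  filter_upwards [hW.1.ae_hasDerivAt_integral, hV.1.ae_hasDerivAt_integral] with x hx hx' hm
  have hm' := uIoc_subset_uIcc hm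
  rw [((hx hm' 0 left_mem_uIcc).const_add _).deriv, ((hx' hm' 0 left_mem_uIcc).const_add _).deriv]
  rw [uIcc_of_le hL] at hm'
  rw [hW.2 x hm', hV.2 x hm']

lemma setIntegral_Ioo (hL : 0 ≤ L) (f : ℝ → ℝ) :
    ∫ x in Ioo 0 L, f x = ∫ x in (0 : ℝ)..L, f x := by
  rw [intervalIntegral.integral_of_le hL, integral_Ioc_eq_integral_Ioo]

lemma eq_zero_of_tsupport_subset {φ : ℝ → ℝ} {U : Set ℝ} (h : tsupport φ ⊆ U) {x : ℝ}
    (hx : x ∉ U) : φ x = 0 :=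
  image_eq_zero_of_notMem_tsupport fun hx' => hx (h hx')

lemma IsPrimitive.hasWeakDeriv (hL : 0 ≤ L) {u v : L2 L} {W w : ℝ → ℝ} (h : IsPrimitive L W w)
    (hu : u =ᵐ[volume.restrict (Ioo 0 L)] W) (hv : v =ᵐ[volume.restrict (Ioo 0 L)] w) :
    HasWeakDeriv u v := by
  intro φ hφ _ hs
  have hφ' : Continuous (deriv φ) := hφ.continuous_deriv (by simp)
  have h1 := h.integral_eq hL (isPrimitive_of_hasDerivAt
    (fun x => (hφ.differentiable (by simp) x).hasDerivAt) hφ')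
  rw [eq_zero_of_tsupport_subset hs (x := 0) (by simp),
    eq_zero_of_tsupport_subset hs (x := L) (by simp), ← setIntegral_Ioo hL] at h1
  have h2 : ∫ x in Ioo 0 L, (v x * φ x + u x * deriv φ x) = 0 := by
    rw [mul_zero, mul_zero, sub_zero] at h1
    refine Eq.trans (integral_congr_ae ?_) h1
    filter_upwards [hu, hv] with x hx hx'
    rw [hx, hx']
  rw [integral_add (integrable_mul v hφ.continuous) (integrable_mul u hφ')] at h2
  linarith

/-- The **du Bois-Reymond lemma** on an interval. -/
lemma exists_ae_eq_const (hL : 0 < L) {w : ℝ → ℝ} (hw : IntegrableOn w (Ioo 0 L))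
    (h : ∀ φ : ℝ → ℝ, ContDiff ℝ ∞ φ → HasCompactSupport φ → tsupport φ ⊆ Ioo 0 L →
      ∫ x in Ioo 0 L, w x * deriv φ x = 0) :
    ∃ c, ∀ᵐ x ∂volume.restrict (Ioo 0 L), w x = c := by
  let b : ContDiffBump (L / 2) := ⟨L / 8, L / 4, by positivity, by linarith⟩
  let ρ : ℝ → ℝ := b.normed volume
  have hρ : ContDiff ℝ ∞ ρ := b.contDiff_normed
  have hρi : ∫ x, ρ x = 1 := b.integral_normed
  have hρs : tsupport ρ ⊆ Ioo 0 L := by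
    rw [show tsupport ρ = _ from b.tsupport_normed_eq, Real.closedBall_eq_Icc]
    intro x hx
    simp only [b] at hx
    exact ⟨by linarith [hx.1], by linarith [hx.2]⟩
  have hρc : HasCompactSupport ρ := b.hasCompactSupport_normed
  have hmul : ∀ ψ : ℝ → ℝ, Continuous ψ → IntegrableOn (fun x => w x * ψ x) (Ioo 0 L) := by
    intro ψ hψ
    obtain ⟨C, hC⟩ := (isCompact_Icc (a := (0 : ℝ)) (b := L)).exists_bound_of_continuousOn
      hψ.continuousOn
    refine hw.mul_bdd (c := C) hψ.aestronglyMeasurable ?_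
    filter_upwards [ae_restrict_mem measurableSet_Ioo] with x hx
    exact hC x (Ioo_subset_Icc_self hx)
  have hset : ∀ ψ f : ℝ → ℝ, tsupport ψ ⊆ Ioo 0 L →
      ∫ x in Ioo 0 L, f x * ψ x = ∫ x, f x * ψ x := fun ψ f hψ =>
    setIntegral_eq_integral_of_forall_compl_eq_zero fun x hx => by
      rw [eq_zero_of_tsupport_subset hψ hx, mul_zero]
  refine ⟨∫ x in Ioo 0 L, w x * ρ x, ?_⟩
  set c := ∫ x in Ioo 0 L, w x * ρ x with hc
  have key := isOpen_Ioo.ae_eq_zero_of_integral_contDiff_smul_eq_zero (μ := volume)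
    (U := Ioo 0 L) (f := fun x => w x - c)
    (hw.sub (integrableOn_const (by simp))).locallyIntegrableOn ?_
  · rw [ae_restrict_iff' measurableSet_Ioo]
    filter_upwards [key] with x hx hx'
    exact sub_eq_zero.1 (hx hx')
  intro ψ hψ hψc hψs
  set m := ∫ x, ψ x with hm
  -- Subtracting `m ρ` gives mean zero, so the primitive of `η` is again compactly supported in
  -- `(0,L)` and is an admissible test function.
  let η : ℝ → ℝ := fun x => ψ x - m * ρ x
  have hη : ContDiff ℝ ∞ η := hψ.sub (contDiff_const.mul hρ)
  have hηc : Continuous η := hη.continuous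
  obtain ⟨α, β, hα, hβ, hαβ⟩ : ∃ α β, 0 < α ∧ β < L ∧ ∀ x ∉ Icc α β, η x = 0 := by
    have hK : IsCompact (tsupport ψ ∪ tsupport ρ) := hψc.isCompact.union hρc.isCompact
    have hKs : tsupport ψ ∪ tsupport ρ ⊆ Ioo 0 L := union_subset hψs hρs
    have hne : (tsupport ψ ∪ tsupport ρ).Nonempty := by
      rw [union_nonempty]
      right
      by_contra hemp
      rw [not_nonempty_iff_eq_empty, tsupport_eq_empty_iff] at hemp
      simp [hemp] at hρi
    -- The interval `[α, β]` spans both supports; compactness keeps its ends strictly inside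
    -- `(0,L)`.
    refine ⟨sInf _, sSup _, (hKs (hK.sInf_mem hne)).1, (hKs (hK.sSup_mem hne)).2, fun x hx => ?_⟩
    have hx' : x ∉ tsupport ψ ∪ tsupport ρ := fun hx' =>
      hx ⟨csInf_le hK.bddBelow hx', le_csSup hK.bddAbove hx'⟩
    rw [mem_union, not_or] at hx'
    simp only [η, image_eq_zero_of_notMem_tsupport hx'.1, image_eq_zero_of_notMem_tsupport hx'.2,
      mul_zero, sub_zero]
  have hηi : ∫ x, η x = 0 := by
    simp only [η]
    rw [integral_sub (hψ.continuous.integrable_of_hasCompactSupport hψc)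
      ((hρ.continuous.integrable_of_hasCompactSupport hρc).const_mul m), integral_const_mul, hρi]
    simp [m]
  let φ : ℝ → ℝ := fun x => ∫ s in (0 : ℝ)..x, η s
  have hφd : ∀ x, HasDerivAt φ (η x) x := fun x =>
    intervalIntegral.integral_hasDerivAt_right (hηc.intervalIntegrable _ _)
      (hηc.stronglyMeasurableAtFilter _ _) hηc.continuousAt
  have hφ' : deriv φ = η := funext fun x => (hφd x).deriv
  have hφ : ContDiff ℝ ∞ φ :=
    contDiff_infty_iff_deriv.2 ⟨fun x => (hφd x).differentiableAt, by rwa [hφ']⟩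
  have hφ0 : ∀ x ∉ Icc α β, φ x = 0 := by
    intro x hx
    by_cases hx1 : x < α
    · refine intervalIntegral.integral_zero_ae (ae_of_all _ fun s hs => hαβ s fun hs' => ?_)
      have := (uIoc_subset_uIcc hs).2
      exact absurd (hs'.1.trans this) (not_le.2 (max_lt hα hx1))
    · have hx2 : β < x := by
        by_contra hx2
        exact hx ⟨not_lt.1 hx1, not_lt.1 hx2⟩
      change ∫ s in (0 : ℝ)..x, η s = 0
      rw [intervalIntegral.integral_eq_integral_of_support_subset, hηi]
      intro s hs
      by_contra hs'
      refine hs (hαβ s fun hs'' => hs' ⟨hα.trans_le hs''.1, hs''.2.trans hx2.le⟩)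
  have hφsub : Function.support φ ⊆ Icc α β := fun x hx => by
    by_contra hx'
    exact hx (hφ0 x hx')
  have hφts : tsupport φ ⊆ Icc α β := closure_minimal hφsub isClosed_Icc
  have h1 := h φ hφ (isCompact_Icc.of_isClosed_subset (isClosed_tsupport _) hφts)
    (hφts.trans (Icc_subset_Ioo hα hβ))
  rw [hφ'] at h1
  have h2 : ∫ x in Ioo 0 L, w x * η x = (∫ x in Ioo 0 L, w x * ψ x) - m * c := by
    rw [hc, ← integral_const_mul, ← integral_sub (hmul ψ hψ.continuous)
      ((hmul ρ hρ.continuous).const_mul m)]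
    refine integral_congr_ae (ae_of_all _ fun x => ?_)
    simp only [η]; ring
  have h3 : ∫ x, ψ x • (w x - c) = ∫ x in Ioo 0 L, (w x - c) * ψ x := by
    rw [hset ψ _ hψs]
    simp only [smul_eq_mul, mul_comm]
  have h4 : ∫ x in Ioo 0 L, (w x - c) * ψ x = (∫ x in Ioo 0 L, w x * ψ x) - c * m := by
    have h5 : m = ∫ x in Ioo 0 L, ψ x :=
      (setIntegral_eq_integral_of_forall_compl_eq_zero fun x hx =>
        eq_zero_of_tsupport_subset hψs hx).symm
    rw [h5, ← integral_const_mul, ← integral_sub (hmul ψ hψ.continuous)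
      ((hψ.continuous.integrable_of_hasCompactSupport hψc).integrableOn.const_mul c)]
    refine integral_congr_ae (ae_of_all _ fun x => ?_)
    simp only; ring
  rw [h3, h4]
  linarith

lemma integrable_indicator (v : L2 L) : Integrable ((Ioo 0 L).indicator v) := by
  rw [integrable_indicator_iff measurableSet_Ioo]
  exact (Lp.memLp v).integrable (by norm_num)

lemma indicator_ae_eq (v : L2 L) :
    v =ᵐ[volume.restrict (Ioo 0 L)] (Ioo 0 L).indicator v :=
  (indicator_ae_eq_restrict measurableSet_Ioo).symm

/-- Subtracting the primitive of `v'` from `u` leaves weak derivative zero, hence a constant. The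
indicator alternative serves the top derivative; the continuous one lets representatives be
integrated again for the lower orders. -/
lemma HasWeakDeriv.exists_ae_eq (hL : 0 < L) {u v : L2 L} (h : HasWeakDeriv u v) {v' : ℝ → ℝ}
    (hv' : Continuous v' ∨ v' = (Ioo 0 L).indicator v) (hv : v =ᵐ[volume.restrict (Ioo 0 L)] v') :
    ∃ c, u =ᵐ[volume.restrict (Ioo 0 L)] fun x => c + ∫ s in (0 : ℝ)..x, v' s := by
  have hi : ∀ a b, IntervalIntegrable v' volume a b := by
    rcases hv' with hv' | rfl
    · exact fun a b => hv'.intervalIntegrable a b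
    · exact fun a b => (integrable_indicator v).intervalIntegrable
  set W : ℝ → ℝ := fun x => 0 + ∫ s in (0 : ℝ)..x, v' s with hW
  have hWc : Continuous W := continuous_const.add (intervalIntegral.continuous_primitive hi 0)
  have hu : IntegrableOn u (Ioo 0 L) := (Lp.memLp u).integrable (by norm_num)
  have hWi : IntegrableOn W (Ioo 0 L) := (hWc.integrableOn_Icc).mono_set Ioo_subset_Icc_self
  obtain ⟨c, hc⟩ := exists_ae_eq_const hL (w := fun x => u x - W x) (hu.sub hWi) fun φ hφ hφc hs => by
    have hφ' : Continuous (deriv φ) := hφ.continuous_deriv (by simp)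
    have h1 := (isPrimitive_integral 0 (hi 0 L)).integral_eq hL.le (isPrimitive_of_hasDerivAt
      (fun x => (hφ.differentiable (by simp) x).hasDerivAt) hφ')
    rw [eq_zero_of_tsupport_subset hs (x := 0) (by simp),
      eq_zero_of_tsupport_subset hs (x := L) (by simp), ← setIntegral_Ioo hL.le, mul_zero, mul_zero,
      sub_zero] at h1
    have hvφ : IntegrableOn (fun x => v' x * φ x) (Ioo 0 L) :=
      (integrable_mul v hφ.continuous).congr (by filter_upwards [hv] with x hx; rw [hx])
    have hWφ : IntegrableOn (fun x => W x * deriv φ x) (Ioo 0 L) :=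
      ((hWc.mul hφ').integrableOn_Icc).mono_set Ioo_subset_Icc_self
    rw [integral_add hvφ hWφ] at h1
    have h2 := h φ hφ hφc hs
    have h3 : ∫ x in Ioo 0 L, v x * φ x = ∫ x in Ioo 0 L, v' x * φ x :=
      integral_congr_ae (by filter_upwards [hv] with x hx; rw [hx])
    simp only [sub_mul]
    rw [integral_sub (integrable_mul u hφ') hWφ, h2, h3]
    linarith
  refine ⟨c, ?_⟩
  filter_upwards [hc] with x hx
  simp only [hW] at hx
  linarith

lemma eq_zero_of_integral_mul_eq_zero {u : L2 L}
    (h : ∀ φ : ℝ → ℝ, ContDiff ℝ ∞ φ → HasCompactSupport φ → tsupport φ ⊆ Ioo 0 L →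
      ∫ x in Ioo 0 L, u x * φ x = 0) : u = 0 := by
  have hu : IntegrableOn u (Ioo 0 L) := (Lp.memLp u).integrable (by norm_num)
  have key := isOpen_Ioo.ae_eq_zero_of_integral_contDiff_smul_eq_zero (μ := volume)
    (U := Ioo 0 L) hu.locallyIntegrableOn fun φ hφ hφc hs => by
      refine Eq.trans ?_ (h φ hφ hφc hs)
      rw [setIntegral_eq_integral_of_forall_compl_eq_zero]
      · simp only [smul_eq_mul, mul_comm]
      · intro x hx
        rw [eq_zero_of_tsupport_subset hs hx, mul_zero]
  refine (Lp.eq_zero_iff_ae_eq_zero).2 ?_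
  rw [EventuallyEq, ae_restrict_iff' measurableSet_Ioo]
  exact key

lemma HasWeakDeriv.eq {u v v' : L2 L} (h : HasWeakDeriv u v) (h' : HasWeakDeriv u v') :
    v = v' := by
  have h1 := h'.add (h.smul (-1))
  rw [← sub_eq_zero, ← neg_eq_zero, neg_sub]
  refine eq_zero_of_integral_mul_eq_zero fun φ hφ hφc hs => ?_
  have h2 := h1 φ hφ hφc hs
  have h3 : v' + (-1 : ℝ) • v = v' - v := by rw [neg_one_smul, sub_eq_add_neg]
  have h4 : u + (-1 : ℝ) • u = (0 : ℝ) • u := by rw [neg_one_smul, add_neg_cancel, zero_smul]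
  rw [h3, h4, integral_smul_mul, zero_mul] at h2
  linarith

lemma memLp_of_continuous {φ : ℝ → ℝ} (hφ : Continuous φ) :
    MemLp φ 2 (volume.restrict (Ioo 0 L)) := by
  obtain ⟨C, hC⟩ := (isCompact_Icc (a := (0 : ℝ)) (b := L)).exists_bound_of_continuousOn
    hφ.continuousOn
  refine MemLp.of_bound hφ.aestronglyMeasurable C ?_
  filter_upwards [ae_restrict_mem measurableSet_Ioo] with x hx
  exact hC x (Ioo_subset_Icc_self hx)

/-- The restriction to `(0,L)` of a continuous function, as an element of `L²(0,L)`. -/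
def ofContinuous (L : ℝ) (φ : C(ℝ, ℝ)) : L2 L :=
  (memLp_of_continuous φ.continuous).toLp φ

lemma integral_mul_eq_inner (u : L2 L) (φ : C(ℝ, ℝ)) :
    ∫ x in Ioo 0 L, u x * φ x = inner ℝ u (ofContinuous L φ) := by
  rw [L2.inner_def]
  refine integral_congr_ae ?_
  filter_upwards [(memLp_of_continuous (L := L) φ.continuous).coeFn_toLp] with x hx
  simp [ofContinuous, hx, mul_comm]

/-- For each test function the condition equates two continuous inner products. This yields
completeness of `H³`, which the closed graph theorem needs. -/
lemma isClosed_hasWeakDeriv {Y : Type*} [TopologicalSpace Y] {f g : Y → L2 L} (hf : Continuous f)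
    (hg : Continuous g) : IsClosed {y | HasWeakDeriv (f y) (g y)} := by
  simp only [HasWeakDeriv, ofPred_forall]
  refine isClosed_iInter fun φ => isClosed_iInter fun hφ => isClosed_iInter fun _ =>
    isClosed_iInter fun _ => ?_
  have h1 := fun u : L2 L => integral_mul_eq_inner u ⟨deriv φ, hφ.continuous_deriv (by simp)⟩
  have h2 := fun u : L2 L => integral_mul_eq_inner u ⟨φ, hφ.continuous⟩
  simp only [ContinuousMap.coe_mk] at h1 h2
  simp only [h1, h2]
  exact isClosed_eq (hf.inner continuous_const) (hg.inner continuous_const).neg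

instance : CompleteSpace (H3 L) := by
  have hk : ∀ k : Fin 4, Continuous fun u : PiLp 2 (fun _ : Fin 4 => L2 L) => u k := fun k => by
    fun_prop
  have h : IsClosed (H3 L : Set (PiLp 2 (fun _ : Fin 4 => L2 L))) :=
    (isClosed_hasWeakDeriv (hk 0) (hk 1)).inter
      ((isClosed_hasWeakDeriv (hk 1) (hk 2)).inter (isClosed_hasWeakDeriv (hk 2) (hk 3)))
  exact h.completeSpace_coe

/-- `D k`, as a bounded operator from `H³(0,L)` to `L²(0,L)`. -/
def DL (k : Fin 4) : H3 L →L[ℝ] L2 L :=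
  (PiLp.proj (𝕜 := ℝ) 2 (fun _ : Fin 4 => L2 L) k).comp (H3 L).subtypeL

lemma D_injective : Function.Injective (D (L := L) 0) := by
  intro u v h
  have h1 : D 1 u = D 1 v := u.2.1.eq (h ▸ v.2.1 : HasWeakDeriv (D 0 u) (D 1 v))
  have h2 : D 2 u = D 2 v := u.2.2.1.eq (h1 ▸ v.2.2.1 : HasWeakDeriv (D 1 u) (D 2 v))
  have h3 : D 3 u = D 3 v := u.2.2.2.eq (h2 ▸ v.2.2.2 : HasWeakDeriv (D 2 u) (D 3 v))
  ext1
  ext1 k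
  fin_cases k
  exacts [h, h1, h2, h3]

/-- On `[0,L]`, the functions `y₁, y₂, y₃` are the first three derivatives of `y`, where `y₃` is
merely integrable. -/
structure IsJet (L : ℝ) (y y₁ y₂ y₃ : ℝ → ℝ) : Prop where
  hasDerivAt : ∀ x, HasDerivAt y (y₁ x) x
  hasDerivAt₁ : ∀ x, HasDerivAt y₁ (y₂ x) x
  continuous₂ : Continuous y₂
  isPrimitive : IsPrimitive L y₂ y₃

/-- The functions `y, y₁, y₂, y₃` represent `u ∈ H³(0,L)` and its derivatives. -/
structure IsRep (u : H3 L) (y y₁ y₂ y₃ : ℝ → ℝ) : Prop extends IsJet L y y₁ y₂ y₃ where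
  ae_eq : D 0 u =ᵐ[volume.restrict (Ioo 0 L)] y
  ae_eq₁ : D 1 u =ᵐ[volume.restrict (Ioo 0 L)] y₁
  ae_eq₂ : D 2 u =ᵐ[volume.restrict (Ioo 0 L)] y₂
  ae_eq₃ : D 3 u =ᵐ[volume.restrict (Ioo 0 L)] y₃

lemma hasDerivAt_const_add_integral (c : ℝ) {f : ℝ → ℝ} (hf : Continuous f) (x : ℝ) :
    HasDerivAt (fun x => c + ∫ s in (0 : ℝ)..x, f s) (f x) x :=
  (intervalIntegral.integral_hasDerivAt_right (hf.intervalIntegrable _ _)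
    (hf.stronglyMeasurableAtFilter _ _) hf.continuousAt).const_add c

/-- Extend `u'''` by zero outside `(0,L)` and integrate three times. The representatives live on all
of `ℝ`, so derivatives at the endpoints are two-sided. -/
lemma exists_isRep (hL : 0 < L) (u : H3 L) : ∃ y y₁ y₂ y₃, IsRep u y y₁ y₂ y₃ := by
  obtain ⟨c₂, h₂⟩ := HasWeakDeriv.exists_ae_eq hL u.2.2.2 (Or.inr rfl) (indicator_ae_eq _)
  have hc₂ : Continuous fun x => c₂ + ∫ s in (0 : ℝ)..x, (Ioo 0 L).indicator (u.1 3) s :=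
    continuous_const.add (intervalIntegral.continuous_primitive
      (fun a b => (integrable_indicator _).intervalIntegrable) 0)
  obtain ⟨c₁, h₁⟩ := HasWeakDeriv.exists_ae_eq hL u.2.2.1 (Or.inl hc₂) h₂
  have hd₁ := hasDerivAt_const_add_integral c₁ hc₂
  have hc₁ := continuous_iff_continuousAt.2 fun x => (hd₁ x).continuousAt
  obtain ⟨c₀, h₀⟩ := HasWeakDeriv.exists_ae_eq hL u.2.1 (Or.inl hc₁) h₁
  exact ⟨_, _, _, _, ⟨hasDerivAt_const_add_integral c₀ hc₁, hd₁, hc₂,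
    isPrimitive_integral c₂ (integrable_indicator _).intervalIntegrable⟩, h₀, h₁, h₂,
    indicator_ae_eq _⟩

namespace IsJet

variable {y y₁ y₂ y₃ φ φ₁ φ₂ φ₃ : ℝ → ℝ}

lemma continuous (h : IsJet L y y₁ y₂ y₃) : Continuous y :=
  continuous_iff_continuousAt.2 fun x => (h.hasDerivAt x).continuousAt

lemma continuous₁ (h : IsJet L y y₁ y₂ y₃) : Continuous y₁ :=
  continuous_iff_continuousAt.2 fun x => (h.hasDerivAt₁ x).continuousAt

lemma isPrimitive₀ (h : IsJet L y y₁ y₂ y₃) : IsPrimitive L y y₁ :=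
  isPrimitive_of_hasDerivAt h.hasDerivAt h.continuous₁

lemma isPrimitive₁ (h : IsJet L y y₁ y₂ y₃) : IsPrimitive L y₁ y₂ :=
  isPrimitive_of_hasDerivAt h.hasDerivAt₁ h.continuous₂

/-- Green's formula for `∂ₓ + ∂ₓ³` and functions that vanish at both ends. -/
lemma green (hL : 0 ≤ L) (h : IsJet L y y₁ y₂ y₃) (h' : IsJet L φ φ₁ φ₂ φ₃) (hy : y 0 = 0)
    (hyL : y L = 0) (hφ : φ 0 = 0) (hφL : φ L = 0) :
    ∫ x in (0 : ℝ)..L, ((y₁ x + y₃ x) * φ x + y x * (φ₁ x + φ₃ x)) =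
      y₁ 0 * φ₁ 0 - y₁ L * φ₁ L := by
  have hi : ∀ {v V W w : ℝ → ℝ}, IntervalIntegrable v volume 0 L → Continuous V → Continuous W →
      IntervalIntegrable w volume 0 L →
      IntervalIntegrable (fun x => v x * V x + W x * w x) volume 0 L := fun hv hV hW hw =>
    (hv.mul_continuousOn hV.continuousOn).add (hw.continuousOn_mul hW.continuousOn)
  have e₁ := h.isPrimitive₀.integral_eq hL h'.isPrimitive₀
  have e₂ := h.isPrimitive.integral_eq hL h'.isPrimitive₀
  have e₃ := h.isPrimitive₁.integral_eq hL h'.isPrimitive₁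
  have e₄ := h.isPrimitive₀.integral_eq hL h'.isPrimitive
  have i₁ := hi h.isPrimitive₀.1 h'.continuous h.continuous h'.isPrimitive₀.1
  have i₂ := hi h.isPrimitive.1 h'.continuous h.continuous₂ h'.isPrimitive₀.1
  have i₃ := hi h.isPrimitive₁.1 h'.continuous₁ h.continuous₁ h'.isPrimitive₁.1
  have i₄ := hi h.isPrimitive₀.1 h'.continuous₂ h.continuous h'.isPrimitive.1
  rw [hy, hyL, hφ, hφL] at *
  -- The integrand is an alternating sum of product derivatives: `(yφ)' + (y₂φ)' - (y₁φ₁)' +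
  -- (yφ₂)'`. Only the third leaves boundary terms.
  have e : ∫ x in (0 : ℝ)..L, ((y₁ x + y₃ x) * φ x + y x * (φ₁ x + φ₃ x)) =
      ∫ x in (0 : ℝ)..L, ((y₁ x * φ x + y x * φ₁ x) + (y₃ x * φ x + y₂ x * φ₁ x)
        - (y₂ x * φ₁ x + y₁ x * φ₂ x) + (y₁ x * φ₂ x + y x * φ₃ x)) :=
    intervalIntegral.integral_congr fun x _ => by ring
  rw [e, intervalIntegral.integral_add ((i₁.add i₂).sub i₃) i₄,
    intervalIntegral.integral_sub (i₁.add i₂) i₃, intervalIntegral.integral_add i₁ i₂, e₁, e₂, e₃,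
    e₄]
  ring

lemma exists_H3_isRep (hL : 0 ≤ L) (h : IsJet L y y₁ y₂ y₃)
    (h₃ : MemLp y₃ 2 (volume.restrict (Ioo 0 L))) : ∃ u : H3 L, IsRep u y y₁ y₂ y₃ := by
  have e₀ := (memLp_of_continuous (L := L) h.continuous).coeFn_toLp
  have e₁ := (memLp_of_continuous (L := L) h.continuous₁).coeFn_toLp
  have e₂ := (memLp_of_continuous (L := L) h.continuous₂).coeFn_toLp
  have e₃ := h₃.coeFn_toLp
  let u : PiLp 2 (fun _ : Fin 4 => L2 L) := WithLp.toLp 2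
    ![(memLp_of_continuous (L := L) h.continuous).toLp,
      (memLp_of_continuous (L := L) h.continuous₁).toLp,
      (memLp_of_continuous (L := L) h.continuous₂).toLp, h₃.toLp]
  exact ⟨⟨u, h.isPrimitive₀.hasWeakDeriv hL e₀ e₁, h.isPrimitive₁.hasWeakDeriv hL e₁ e₂,
    h.isPrimitive.hasWeakDeriv hL e₂ e₃⟩, h, e₀, e₁, e₂, e₃⟩

end IsJet

namespace IsRep

variable {u : H3 L} {y y₁ y₂ y₃ : ℝ → ℝ}

lemma trace_eq (h : IsRep u y y₁ y₂ y₃) (hL : 0 < L) {x : ℝ} (hx : x ∈ Icc 0 L) :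
    trace (D 0 u) x = y x :=
  KdVODE.trace_eq hL h.continuous.continuousOn h.ae_eq hx

lemma trace_eq₁ (h : IsRep u y y₁ y₂ y₃) (hL : 0 < L) {x : ℝ} (hx : x ∈ Icc 0 L) :
    trace (D 1 u) x = y₁ x :=
  KdVODE.trace_eq hL h.continuous₁.continuousOn h.ae_eq₁ hx

end IsRep

end Sobolev

/-! ### The stationary third-order boundary value problem and its adjoint. -/

section BoundaryValueProblem

lemma exp_smul_mul_exp_neg_smul {V : Type*} [NormedAddCommGroup V] [NormedSpace ℝ V]
    [CompleteSpace V] (M : V →L[ℝ] V) (t : ℝ) :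
    NormedSpace.exp (t • M) * NormedSpace.exp ((-t) • M) = 1 := by
  let _ : NormedAlgebra ℚ (V →L[ℝ] V) := NormedAlgebra.restrictScalars ℚ ℝ _
  rw [← NormedSpace.exp_add_of_commute (((Commute.refl M).smul_left t).smul_right (-t)),
    ← add_smul, add_neg_cancel, zero_smul, NormedSpace.exp_zero]

/-- The solution of `Y' = M Y + F` given by the variation of constants formula. -/
lemma hasDerivAt_variation_of_constants {V : Type*} [NormedAddCommGroup V] [NormedSpace ℝ V]
    [CompleteSpace V] (M : V →L[ℝ] V) (Y₀ : V) {F : ℝ → V} (hF : Continuous F) (x : ℝ) :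
    HasDerivAt (fun x : ℝ => NormedSpace.exp (x • M)
        (Y₀ + ∫ s in (0 : ℝ)..x, NormedSpace.exp ((-s) • M) (F s)))
      (M (NormedSpace.exp (x • M)
        (Y₀ + ∫ s in (0 : ℝ)..x, NormedSpace.exp ((-s) • M) (F s))) + F x) x := by
  have h1 := hasDerivAt_exp_smul_const' (𝕂 := ℝ) M x
  have hc : Continuous fun s : ℝ => NormedSpace.exp ((-s) • M) :=
    (continuous_iff_continuousAt.2 fun s =>
      (hasDerivAt_exp_smul_const (𝕂 := ℝ) M s).continuousAt).comp continuous_neg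
  have hG : Continuous fun s : ℝ => NormedSpace.exp ((-s) • M) (F s) := hc.clm_apply hF
  have h2 := (intervalIntegral.integral_hasDerivAt_right (hG.intervalIntegrable 0 x)
    (hG.stronglyMeasurableAtFilter _ _) hG.continuousAt).const_add Y₀
  refine (h1.clm_apply h2).congr_deriv ?_
  have h4 := DFunLike.congr_fun (exp_smul_mul_exp_neg_smul M x) (F x)
  change NormedSpace.exp (x • M) (NormedSpace.exp ((-x) • M) (F x)) = F x at h4
  rw [h4]
  rfl

/-- The matrix of `y''' + y' + l y = 0`, written as a system of first order. -/
def companion (l : ℝ) : (ℝ × ℝ × ℝ) →L[ℝ] (ℝ × ℝ × ℝ) :=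
  LinearMap.toContinuousLinearMap
    { toFun := fun Y => (Y.2.1, Y.2.2, -(l * Y.1) - Y.2.1)
      map_add' := fun X Y => by ext <;> simp; ring
      map_smul' := fun r Y => by ext <;> simp; ring }

lemma companion_apply (l : ℝ) (Y : ℝ × ℝ × ℝ) :
    companion l Y = (Y.2.1, Y.2.2, -(l * Y.1) - Y.2.1) := rfl

/-- As `f` is merely integrable, `y₂ - ∫ f` is taken as the third unknown. The forcing becomes `(0,
∫ f, 0)`, which is continuous, and classical variation of constants applies. The solution is affine
in `Y₀`, with `Q` independent of `Y₀`. -/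
lemma exists_initial_value_problem (l : ℝ) {f : ℝ → ℝ}
    (hf : ∀ x y, IntervalIntegrable f volume x y) :
    ∃ Q : ℝ → ℝ × ℝ × ℝ, Q 0 = 0 ∧ ∀ Y₀ : ℝ × ℝ × ℝ, ∃ y y₁ y₂ : ℝ → ℝ,
      (∀ x, (y x, y₁ x, y₂ x) = NormedSpace.exp (x • companion l) Y₀ + Q x) ∧
      (∀ x, HasDerivAt y (y₁ x) x) ∧ (∀ x, HasDerivAt y₁ (y₂ x) x) ∧ Continuous y₂ ∧
      ∀ x, y₂ x = y₂ 0 + ∫ s in (0 : ℝ)..x, (f s - l * y s - y₁ s) := by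
  set G : ℝ → ℝ := fun x => ∫ s in (0 : ℝ)..x, f s with hG
  have hGc : Continuous G := intervalIntegral.continuous_primitive hf 0
  let F : ℝ → ℝ × ℝ × ℝ := fun x => (0, G x, 0)
  have hF : Continuous F := by fun_prop
  refine ⟨fun x => NormedSpace.exp (x • companion l)
    (∫ s in (0 : ℝ)..x, NormedSpace.exp ((-s) • companion l) (F s)) + (0, 0, G x), by simp [G],
    fun Y₀ => ?_⟩
  set Y : ℝ → ℝ × ℝ × ℝ := fun x => NormedSpace.exp (x • companion l)
        (Y₀ + ∫ s in (0 : ℝ)..x, NormedSpace.exp ((-s) • companion l) (F s)) with hY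
  have hd : ∀ x, HasDerivAt Y (companion l (Y x) + F x) x :=
    hasDerivAt_variation_of_constants (companion l) Y₀ hF
  simp only [companion_apply, F, Prod.mk_add_mk, add_zero] at hd
  have hYc : Continuous Y := continuous_iff_continuousAt.2 fun x => (hd x).continuousAt
  refine ⟨fun x => (Y x).1, fun x => (Y x).2.1, fun x => (Y x).2.2 + G x, fun x => ?_,
    fun x => (hd x).fst, fun x => (hd x).snd.fst, by fun_prop, fun x => ?_⟩
  · simp only [hY, map_add]
    ext
    all_goals simp; try ring
  · have h1 : Continuous fun s => -(l * (Y s).1) - (Y s).2.1 := by fun_prop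
    have h2 := intervalIntegral.integral_eq_sub_of_hasDerivAt (a := 0) (b := x)
      (fun s _ => (hd s).snd.snd) (h1.intervalIntegrable _ _)
    have h3 : ∫ s in (0 : ℝ)..x, (f s - l * (Y s).1 - (Y s).2.1) =
        G x + ∫ s in (0 : ℝ)..x, (-(l * (Y s).1) - (Y s).2.1) := by
      rw [hG, ← intervalIntegral.integral_add (hf _ _) (h1.intervalIntegrable _ _)]
      exact intervalIntegral.integral_congr fun s _ => by ring
    rw [h3, h2]
    simp only [G, intervalIntegral.integral_same]
    ring

variable {L : ℝ}

lemma IsJet.energy (hL : 0 ≤ L) {y y₁ y₂ y₃ : ℝ → ℝ} (h : IsJet L y y₁ y₂ y₃) (hy : y 0 = 0)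
    (hyL : y L = 0) :
    ∫ x in (0 : ℝ)..L, (y₁ x + y₃ x) * y x = (y₁ 0 ^ 2 - y₁ L ^ 2) / 2 := by
  have h1 := h.green hL h hy hyL hy hyL
  have h2 : ∫ x in (0 : ℝ)..L, ((y₁ x + y₃ x) * y x + y x * (y₁ x + y₃ x)) =
      2 * ∫ x in (0 : ℝ)..L, (y₁ x + y₃ x) * y x := by
    rw [← intervalIntegral.integral_const_mul]
    exact intervalIntegral.integral_congr fun x _ => by ring
  linarith

/-- Young's inequality `c p z ≤ c² z²/2 + p²/2`: the dissipation at `x = 0` absorbs the coupling. -/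
lemma boundary_form_le {a b c κ : ℝ} (hκ : a ^ 2 / 2 + b + c ^ 2 / 2 ≤ κ) (p z : ℝ) :
    (a * z) ^ 2 / 2 - p ^ 2 / 2 + (b * z + c * p) * z ≤ κ * z ^ 2 := by
  nlinarith [sq_nonneg (c * z - p), mul_le_mul_of_nonneg_right hκ (sq_nonneg z)]

/-- The energy identity gives `l ∫ y² + (l - κ) z² ≤ 0`, so `z = 0` and `y = 0` on `[0,L]`. The
midpoint is used because `y` vanishes in a full neighbourhood of it, and so do its derivatives. -/
lemma eq_zero_of_homogeneous (hL : 0 < L) {a b c l κ : ℝ} (hκ₀ : 0 ≤ κ)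
    (hκ : a ^ 2 / 2 + b + c ^ 2 / 2 ≤ κ) (hl : κ < l) {y y₁ y₂ : ℝ → ℝ} {z : ℝ}
    (h : IsJet L y y₁ y₂ fun x => -(l * y x) - y₁ x) (hy : y 0 = 0) (hyL : y L = 0)
    (hz : y₁ L = a * z) (hg : (l - b) * z - c * y₁ 0 = 0) :
    z = 0 ∧ y (L / 2) = 0 ∧ y₁ (L / 2) = 0 ∧ y₂ (L / 2) = 0 := by
  have h1 := h.energy hL.le hy hyL
  have h2 : ∫ x in (0 : ℝ)..L, (y₁ x + (-(l * y x) - y₁ x)) * y x =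
      -l * ∫ x in (0 : ℝ)..L, y x ^ 2 := by
    rw [← intervalIntegral.integral_const_mul]
    exact intervalIntegral.integral_congr fun x _ => by ring
  have h3 := boundary_form_le hκ (y₁ 0) z
  have h4 : 0 ≤ ∫ x in (0 : ℝ)..L, y x ^ 2 :=
    intervalIntegral.integral_nonneg hL.le fun x _ => sq_nonneg _
  rw [h2, hz] at h1
  have h5 : l * (∫ x in (0 : ℝ)..L, y x ^ 2) + (l - κ) * z ^ 2 ≤ 0 := by
    have : (b * z + c * y₁ 0) * z = l * z ^ 2 := by
      rw [show b * z + c * y₁ 0 = l * z by linarith]; ring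
    nlinarith
  have hl0 : 0 < l := hκ₀.trans_lt hl
  have h6 : 0 ≤ (l - κ) * z ^ 2 := mul_nonneg (sub_pos.2 hl).le (sq_nonneg z)
  have h7 : 0 ≤ l * ∫ x in (0 : ℝ)..L, y x ^ 2 := mul_nonneg hl0.le h4
  have hz0 : z = 0 := by
    have : (l - κ) * z ^ 2 = 0 := by linarith
    simpa [(sub_pos.2 hl).ne'] using this
  have hy0 : ∫ x in Ioo 0 L, y x ^ 2 = 0 := by
    rw [setIntegral_Ioo hL.le]
    have : l * ∫ x in (0 : ℝ)..L, y x ^ 2 = 0 := by linarith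
    simpa [hl0.ne'] using this
  have hc := h.continuous
  rw [setIntegral_eq_zero_iff_of_nonneg_ae (ae_of_all _ fun x => sq_nonneg _)
    (((hc.pow 2).integrableOn_Icc).mono_set Ioo_subset_Icc_self)] at hy0
  rw [Measure.restrict_congr_set Ioo_ae_eq_Icc] at hy0
  have h8 := Measure.eqOn_Icc_of_ae_eq volume hL.ne hy0 (hc.pow 2).continuousOn
    continuous_zero.continuousOn
  have hmem : Ioo 0 L ∈ 𝓝 (L / 2) := isOpen_Ioo.mem_nhds ⟨by linarith, by linarith⟩
  have e₀ : y =ᶠ[𝓝 (L / 2)] 0 := by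
    filter_upwards [hmem] with x hx
    simpa using h8 (Ioo_subset_Icc_self hx)
  have d₀ : deriv y = y₁ := funext fun x => (h.hasDerivAt x).deriv
  have d₁ : deriv y₁ = y₂ := funext fun x => (h.hasDerivAt₁ x).deriv
  have e₁ := e₀.deriv
  rw [d₀] at e₁
  have e₂ := e₁.deriv
  rw [d₁] at e₂
  refine ⟨hz0, e₀.eq_of_nhds, ?_, ?_⟩
  · rw [e₁.eq_of_nhds]; simp
  · rw [e₂.eq_of_nhds]
    have : deriv (0 : ℝ → ℝ) = 0 := by ext; simp
    rw [this, this]; rfl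

/-- The stationary boundary value problem. -/
theorem exists_boundary_value_problem (hL : 0 < L) {a b c l κ : ℝ} (hκ₀ : 0 ≤ κ)
    (hκ : a ^ 2 / 2 + b + c ^ 2 / 2 ≤ κ) (hl : κ < l) {f : ℝ → ℝ}
    (hf : ∀ x y, IntervalIntegrable f volume x y) (g : ℝ) :
    ∃ (y y₁ y₂ : ℝ → ℝ) (z : ℝ), IsJet L y y₁ y₂ (fun x => f x - l * y x - y₁ x) ∧
      (∀ x, y₂ x = y₂ 0 + ∫ s in (0 : ℝ)..x, (f s - l * y s - y₁ s)) ∧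
      y 0 = 0 ∧ y L = 0 ∧ y₁ L = a * z ∧ (l - b) * z - c * y₁ 0 = g := by
  set P := NormedSpace.exp (L • companion l) with hP
  -- `Φ` sends the initial data `(y, y', y'')(0)` and `z` to the three boundary defects and the ODE
  -- defect. Source and target have equal dimension, so injectivity suffices.
  let Φ : ((ℝ × ℝ × ℝ) × ℝ) →ₗ[ℝ] ((ℝ × ℝ × ℝ) × ℝ) :=
    { toFun := fun v => ((v.1.1, (P v.1).1, (P v.1).2.1 - a * v.2), (l - b) * v.2 - c * v.1.2.1)
      map_add' := fun v w => by ext <;> simp <;> ring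
      map_smul' := fun r v => by ext <;> simp <;> ring }
  have hjet : ∀ {f : ℝ → ℝ}, (∀ x y, IntervalIntegrable f volume x y) → ∀ {y y₁ y₂ : ℝ → ℝ},
      (∀ x, HasDerivAt y (y₁ x) x) → (∀ x, HasDerivAt y₁ (y₂ x) x) → Continuous y₂ →
      (∀ x, y₂ x = y₂ 0 + ∫ s in (0 : ℝ)..x, (f s - l * y s - y₁ s)) →
      IsJet L y y₁ y₂ (fun x => f x - l * y x - y₁ x) := by
    intro f hf y y₁ y₂ h₀ h₁ h₂ hp
    have c₀ := continuous_iff_continuousAt.2 fun x => (h₀ x).continuousAt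
    have c₁ := continuous_iff_continuousAt.2 fun x => (h₁ x).continuousAt
    exact ⟨h₀, h₁, h₂, ((hf _ _).sub ((continuous_const.mul c₀).intervalIntegrable _ _)).sub
      (c₁.intervalIntegrable _ _), fun x _ => hp x⟩
  have hinj : Function.Injective Φ := by
    refine (injective_iff_map_eq_zero Φ).2 fun v hv => ?_
    have e₁ : v.1.1 = 0 := congrArg (fun w => w.1.1) hv
    have e₂ : (P v.1).1 = 0 := congrArg (fun w => w.1.2.1) hv
    have e₃ : (P v.1).2.1 - a * v.2 = 0 := congrArg (fun w => w.1.2.2) hv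
    have e₄ : (l - b) * v.2 - c * v.1.2.1 = 0 := congrArg (fun w => w.2) hv
    set Y : ℝ → ℝ × ℝ × ℝ := fun x => NormedSpace.exp (x • companion l) v.1 with hY
    have hd : ∀ x, HasDerivAt Y (companion l (Y x)) x := fun x => by
      have h1 := hasDerivAt_exp_smul_const' (𝕂 := ℝ) (companion l) x
      simpa using h1.clm_apply (hasDerivAt_const x v.1)
    have hYc : Continuous Y := continuous_iff_continuousAt.2 fun x => (hd x).continuousAt
    have hY0 : Y 0 = v.1 := by simp [Y]
    simp only [companion_apply] at hd
    have hj : IsJet L (fun x => (Y x).1) (fun x => (Y x).2.1) (fun x => (Y x).2.2)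
        (fun x => -(l * (Y x).1) - (Y x).2.1) :=
      ⟨fun x => (hd x).fst, fun x => (hd x).snd.fst, by fun_prop,
        isPrimitive_of_hasDerivAt (fun x => (hd x).snd.snd) (by fun_prop)⟩
    obtain ⟨hz, h₀, h₁, h₂⟩ := eq_zero_of_homogeneous hL hκ₀ hκ hl hj (z := v.2)
      (by simp only [hY0, e₁]) e₂ (sub_eq_zero.1 e₃) (by simp only [hY0]; exact e₄)
    have h3 : Y (L / 2) = 0 := Prod.ext h₀ (Prod.ext h₁ h₂)
    -- Invertibility of the flow carries the vanishing at `L / 2` back to the initial data.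
    have h4 := exp_smul_mul_exp_neg_smul (companion l) (-(L / 2))
    rw [neg_neg] at h4
    have h5 := DFunLike.congr_fun h4 v.1
    change NormedSpace.exp ((-(L / 2)) • companion l) (Y (L / 2)) = v.1 at h5
    rw [h3, map_zero] at h5
    exact Prod.ext h5.symm hz
  obtain ⟨Q, hQ0, hQ⟩ := exists_initial_value_problem l hf
  obtain ⟨v, hv⟩ := (LinearMap.injective_iff_surjective.1 hinj)
    ((0, -(Q L).1, -(Q L).2.1), g)
  have e₁ : v.1.1 = 0 := congrArg (fun w => w.1.1) hv
  have e₂ : (P v.1).1 = -(Q L).1 := congrArg (fun w => w.1.2.1) hv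
  have e₃ : (P v.1).2.1 - a * v.2 = -(Q L).2.1 := congrArg (fun w => w.1.2.2) hv
  have e₄ : (l - b) * v.2 - c * v.1.2.1 = g := congrArg (fun w => w.2) hv
  obtain ⟨y, y₁, y₂, hy, h₀, h₁, h₂, hp⟩ := hQ v.1
  have hy0 := hy 0
  have hyL := hy L
  rw [hQ0, zero_smul, NormedSpace.exp_zero, add_zero] at hy0
  have i₀ : y 0 = v.1.1 := congrArg (fun w => w.1) hy0
  have i₁ : y₁ 0 = v.1.2.1 := congrArg (fun w => w.2.1) hy0
  have j₀ : y L = (P v.1).1 + (Q L).1 := congrArg (fun w => w.1) hyL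
  have j₁ : y₁ L = (P v.1).2.1 + (Q L).2.1 := congrArg (fun w => w.2.1) hyL
  exact ⟨y, y₁, y₂, v.2, hjet hf h₀ h₁ h₂ hp, hp, by rw [i₀, e₁], by rw [j₀, e₂]; ring,
    by rw [j₁]; linarith, by rw [i₁, e₄]⟩

/-- Bootstrap: the equation turns `n` derivatives of `y, y₁, y₂` into `n + 1`. -/
lemma contDiff_of_hasDerivAt {y y₁ y₂ f : ℝ → ℝ} {l : ℝ} (hf : ContDiff ℝ ∞ f)
    (h₀ : ∀ x, HasDerivAt y (y₁ x) x) (h₁ : ∀ x, HasDerivAt y₁ (y₂ x) x)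
    (h₂ : ∀ x, HasDerivAt y₂ (f x - l * y x - y₁ x) x) : ContDiff ℝ ∞ y := by
  have d : ∀ {u v : ℝ → ℝ}, (∀ x, HasDerivAt u (v x) x) → ∀ n : ℕ, ContDiff ℝ n v →
      ContDiff ℝ (n + 1 : ℕ) u := fun {u v} h n hn => by
    push_cast
    refine contDiff_succ_iff_deriv.2 ⟨fun x => (h x).differentiableAt, by simp, ?_⟩
    rwa [show deriv u = v from funext fun x => (h x).deriv]
  have c : ∀ {u v : ℝ → ℝ}, (∀ x, HasDerivAt u (v x) x) → ContDiff ℝ (0 : ℕ) u := fun h =>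
    contDiff_zero.2 (continuous_iff_continuousAt.2 fun x => (h x).continuousAt)
  have key : ∀ n : ℕ, ContDiff ℝ n y ∧ ContDiff ℝ n y₁ ∧ ContDiff ℝ n y₂ := by
    intro n
    induction n with
    | zero => exact ⟨c h₀, c h₁, c h₂⟩
    | succ n ih =>
      exact ⟨d h₀ n ih.2.1, d h₁ n ih.2.2, d h₂ n
        (((hf.of_le (mod_cast le_top)).sub (contDiff_const.mul ih.1)).sub ih.2.1)⟩
  exact contDiff_infty.2 fun n => (key n).1

/-- The adjoint boundary value problem, for smooth right-hand sides. -/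
theorem exists_adjoint_boundary_value_problem (hL : 0 < L) {a b c l κ : ℝ} (hκ₀ : 0 ≤ κ)
    (hκ : a ^ 2 / 2 + b + c ^ 2 / 2 ≤ κ) (hl : κ < l) {f : ℝ → ℝ} (hf : ContDiff ℝ ∞ f) (g : ℝ) :
    ∃ (φ : ℝ → ℝ) (q : ℝ), ContDiff ℝ ∞ φ ∧ φ 0 = 0 ∧ φ L = 0 ∧ deriv φ 0 = c * q ∧
      (∀ x, l * φ x - (deriv φ x + iteratedDeriv 3 φ x) = f x) ∧
      l * q - (b * q + a * deriv φ L) = g := by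
  have hf' : ContDiff ℝ ∞ fun x => f (L - x) := hf.comp (contDiff_const.sub contDiff_id)
  -- Under `φ(x) = y(L - x)` odd derivatives change sign and the ends are exchanged. The adjoint
  -- problem thus becomes the original one with `(a, c)` replaced by `(-c, -a)`, and `κ` is
  -- unaffected.
  obtain ⟨y, y₁, y₂, z, hj, hp, hy0, hyL, hz, hg⟩ := exists_boundary_value_problem hL (a := -c)
    (b := b) (c := -a) (κ := κ) hκ₀ (by linarith [neg_sq a, neg_sq c]) hl
    (fun x y => hf'.continuous.intervalIntegrable x y) g
  have h₂ : ∀ x, HasDerivAt y₂ (f (L - x) - l * y x - y₁ x) x := by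
    have hc : Continuous fun x => f (L - x) - l * y x - y₁ x :=
      (hf'.continuous.sub (continuous_const.mul hj.continuous)).sub hj.continuous₁
    intro x
    have h1 := hasDerivAt_const_add_integral (y₂ 0) hc x
    rwa [← show y₂ = _ from funext hp] at h1
  have hy := contDiff_of_hasDerivAt hf' hj.hasDerivAt hj.hasDerivAt₁ h₂
  have hr : ∀ {u v : ℝ → ℝ}, (∀ x, HasDerivAt u (v x) x) → ∀ x,
      HasDerivAt (fun x => u (L - x)) (-(v (L - x))) x := fun h x =>
    (h (L - x)).comp_const_sub L x
  have d₁ : deriv (fun x => y (L - x)) = fun x => -(y₁ (L - x)) :=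
    funext fun x => (hr hj.hasDerivAt x).deriv
  have d₂ : deriv (fun x => -(y₁ (L - x))) = fun x => y₂ (L - x) :=
    funext fun x => by simpa using (hr hj.hasDerivAt₁ x).neg.deriv
  have d₃ : deriv (fun x => y₂ (L - x)) =
      fun x => -(f (L - (L - x)) - l * y (L - x) - y₁ (L - x)) :=
    funext fun x => (hr h₂ x).deriv
  have d : iteratedDeriv 3 (fun x => y (L - x)) =
      fun x => -(f (L - (L - x)) - l * y (L - x) - y₁ (L - x)) := by
    rw [iteratedDeriv_succ', iteratedDeriv_succ', iteratedDeriv_one, d₁, d₂, d₃]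
  refine ⟨fun x => y (L - x), z, hy.comp (contDiff_const.sub contDiff_id), by simpa using hyL,
    by simpa using hy0, ?_, fun x => ?_, ?_⟩
  · rw [d₁]; simp [hz]
  · rw [d, d₁]; simp only [sub_sub_cancel]; ring
  · rw [d₁]; simp only [sub_self]; linarith

end BoundaryValueProblem

/-! ### Energy uniqueness and the abstract weak formulation. -/

section WeakFormulation

variable {X E : Type*} [NormedAddCommGroup X] [InnerProductSpace ℝ X]
  [AddCommGroup E] [Module ℝ E] {ι A : E →ₗ[ℝ] X} {κ : ℝ}

lemma IsMDissipative.inner_le (h : IsMDissipative ι (A - κ • ι)) (e : E) :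
    inner ℝ (A e) (ι e) ≤ κ * ‖ι e‖ ^ 2 := by
  have := h.dissipative e
  rw [LinearMap.sub_apply, LinearMap.smul_apply, inner_sub_left, real_inner_smul_left,
    real_inner_self_eq_norm_sq] at this
  linarith

/-- Curves in the domain with `u' = A u` are determined by their initial values. -/
lemma IsMDissipative.eqOn (h : IsMDissipative ι (A - κ • ι)) {e e' : ℝ → E}
    (he : ∀ t ∈ Ici (0 : ℝ), HasDerivWithinAt (fun t => ι (e t)) (A (e t)) (Ici 0) t)
    (he' : ∀ t ∈ Ici (0 : ℝ), HasDerivWithinAt (fun t => ι (e' t)) (A (e' t)) (Ici 0) t)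
    (h₀ : e 0 = e' 0) {t : ℝ} (ht : 0 ≤ t) : e t = e' t := by
  have h1 := norm_le_of_inner_deriv_le (u := fun t => ι (e t - e' t))
    (u' := fun t => A (e t - e' t)) (κ := κ)
    (fun t ht => by simpa only [map_sub] using (he t ht).fun_sub (he' t ht))
    (fun t _ => h.inner_le _) ht
  simp only [h₀, sub_self, map_zero, norm_zero, mul_zero] at h1
  have h2 : ι (e t - e' t) = 0 := norm_le_zero_iff.1 h1
  exact sub_eq_zero.1 (h.injective (h2.trans (map_zero ι).symm))

variable [CompleteSpace X]

/-- The orbits of the semigroup satisfy `u' = A u` weakly. -/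
lemma IsMDissipative.inner_semigroup (h : IsMDissipative ι (A - κ • ι)) {ψ ψ' : X}
    (hψ : ∀ e, inner ℝ (A e) ψ = inner ℝ (ι e) ψ') (x : X) {t : ℝ} (ht : 0 ≤ t) :
    inner ℝ (Real.exp (κ * t) • h.semigroup t x) ψ = inner ℝ x ψ +
      ∫ s in (0 : ℝ)..t, inner ℝ (Real.exp (κ * s) • h.semigroup s x) ψ' := by
  have hexp : Continuous fun t : ℝ => Real.exp (κ * t) := by fun_prop
  have hc : ∀ x, ContinuousOn (fun s => inner ℝ (Real.exp (κ * s) • h.semigroup s x) ψ') (Ici 0) :=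
    fun x => (hexp.continuousOn.smul (h.continuousOn_semigroup x)).inner continuousOn_const
  have huIcc : uIcc 0 t ⊆ Ici (0 : ℝ) := by rw [uIcc_of_le ht]; exact Icc_subset_Ici_self
  have hi : ∀ x, IntervalIntegrable (fun s => inner ℝ (Real.exp (κ * s) • h.semigroup s x) ψ')
      volume 0 t := fun x => ((hc x).mono huIcc).intervalIntegrable
  -- Both sides are continuous in `x`, so the identity needs checking only on the dense domain.
  have hcl : IsClosed {x | inner ℝ (Real.exp (κ * t) • h.semigroup t x) ψ = inner ℝ x ψ +
      ∫ s in (0 : ℝ)..t, inner ℝ (Real.exp (κ * s) • h.semigroup s x) ψ'} := by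
    refine isClosed_eq (((h.continuous_semigroup ht).const_smul _).inner continuous_const)
      ((continuous_id.inner continuous_const).add (continuous_iff_continuousAt.2 fun x => ?_))
    refine intervalIntegral.continuousAt_of_dominated_interval
      (bound := fun s => Real.exp (κ * s) * (‖x‖ + 1) * ‖ψ'‖)
      (Eventually.of_forall fun y => (hi y).def'.aestronglyMeasurable) ?_
      (by apply Continuous.intervalIntegrable; fun_prop) (ae_of_all _ fun s hs => ?_)
    · filter_upwards [Metric.ball_mem_nhds x one_pos] with y hy
      refine ae_of_all _ fun s hs => ?_
      have hs0 := huIcc (uIoc_subset_uIcc hs)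
      have hy' : ‖y‖ ≤ ‖x‖ + 1 := by
        rw [mem_ball_iff_norm] at hy
        have := norm_le_norm_add_norm_sub' y x
        linarith
      refine (norm_inner_le_norm _ _).trans ?_
      rw [norm_smul, Real.norm_of_nonneg (Real.exp_pos _).le]
      gcongr
      exact (h.norm_semigroup_le hs0 y).trans hy'
    · have hs0 := huIcc (uIoc_subset_uIcc hs)
      exact (((h.continuous_semigroup hs0).const_smul _).inner continuous_const).continuousAt
  refine h.denseRange.induction_on x hcl fun e => ?_
  obtain ⟨v, -, -, -, hv⟩ := exists_classical_solution h e
  have hd : ∀ s ∈ Ici (0 : ℝ), HasDerivWithinAt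
      (fun s => inner ℝ (Real.exp (κ * s) • h.semigroup s (ι e)) ψ)
      (inner ℝ (Real.exp (κ * s) • h.semigroup s (ι e)) ψ') (Ici 0) s := fun s hs => by
    have h1 := (hv s hs).2.inner ℝ (hasDerivWithinAt_const s (Ici 0) ψ)
    rw [inner_zero_right, zero_add, hψ, ← h.resolventL_apply, (hv s hs).1] at h1
    exact h1.congr (fun r hr => by rw [(hv r hr).1]) (by rw [(hv s hs).1])
  rw [intervalIntegral.integral_eq_sub_of_hasDeriv_right_of_le ht
    (fun s hs => ((hd s hs.1).continuousWithinAt).mono Icc_subset_Ici_self)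
    (fun s hs => (hd s hs.1.le).mono fun r hr => (hs.1.trans hr).le) (hi (ι e))]
  simp [h.semigroup_zero]

/-- A weak solution of `u' = A u` with zero initial value vanishes, if there are sufficiently many
test elements. -/
lemma IsMDissipative.eq_zero_of_weak (h : IsMDissipative ι (A - κ • ι)) {T : Set (X × X)}
    (hT : ∀ p ∈ T, ∀ e, inner ℝ (A e) p.1 = inner ℝ (ι e) p.2)
    (hdense : ∀ x, (∀ p ∈ T, inner ℝ x ((1 + κ) • p.1 - p.2) = 0) → x = 0) {w : ℝ → X}
    (hw : ContinuousOn w (Ici 0))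
    (hweak : ∀ p ∈ T, ∀ t ∈ Ici (0 : ℝ), inner ℝ (w t) p.1 = ∫ s in (0 : ℝ)..t, inner ℝ (w s) p.2)
    {t : ℝ} (ht : 0 ≤ t) : w t = 0 := by
  let W : ℝ → X := fun t => ∫ s in (0 : ℝ)..t, w s
  have hW : ∀ t ∈ Ici (0 : ℝ), ∀ p ∈ T, inner ℝ (w t) p.1 = inner ℝ (W t) p.2 := by
    intro t ht p hp
    have hi : IntervalIntegrable w volume 0 t := ContinuousOn.intervalIntegrable
      (hw.mono (by rw [uIcc_of_le ht]; exact Icc_subset_Ici_self))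
    have h1 := (innerSL ℝ p.2).intervalIntegral_comp_comm hi
    simp only [innerSL_apply_apply] at h1
    rw [hweak p hp t ht, real_inner_comm, ← h1]
    simp only [real_inner_comm]
  have key : ∀ t ∈ Ici (0 : ℝ), ∃ e, ι e = W t ∧ A e = w t := by
    intro t ht
    -- If `A W = w` is to hold, then `W` must be the solution `e` of `(1 + κ) e - A e = (1 + κ) W -
    -- w`. Testing shows that `ι e - W` is orthogonal to every `(1 + κ) ψ - A* ψ`, so it vanishes.
    obtain ⟨e, he⟩ := h.surjective 1 one_pos ((1 + κ) • W t - w t)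
    have he' : A e = (1 + κ) • ι e - ((1 + κ) • W t - w t) := by
      rw [← he, LinearMap.sub_apply, LinearMap.smul_apply]
      module
    have h1 : ι e = W t := by
      refine sub_eq_zero.1 (hdense _ fun p hp => ?_)
      have h2 := hT p hp e
      rw [he'] at h2
      simp only [inner_sub_left, inner_sub_right, real_inner_smul_left, real_inner_smul_right]
        at h2 ⊢
      have h3 := hW t ht p hp
      linarith
    exact ⟨e, h1, by rw [he', h1, sub_sub_cancel]⟩
  have hzero : ∀ t ∈ Ici (0 : ℝ), W t = 0 := by
    intro t ht
    have h1 := norm_le_of_inner_deriv_le (u := W) (κ := κ)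
      (fun t ht => hasDerivWithinAt_integral_Ici hw ht) (fun t ht => by
        obtain ⟨e, he, he'⟩ := key t ht
        rw [← he, ← he']
        exact h.inner_le e) ht
    simp only [W, intervalIntegral.integral_same, norm_zero, mul_zero] at h1
    exact norm_le_zero_iff.1 h1
  obtain ⟨e, he, he'⟩ := key t ht
  rw [hzero t ht] at he
  have : e = 0 := h.injective (he.trans (map_zero ι).symm)
  rw [← he', this, map_zero]

end WeakFormulation

/-! ### The generator of the KdV-ODE system on its state space. -/

section System

variable {L : ℝ}

/-- The state space `L²(0,L) × ℝ`, as a Hilbert space. -/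
abbrev State (L : ℝ) : Type := WithLp 2 (L2 L × ℝ)

/-- The embedding of `H³(0,L) × ℝ` into the state space. -/
def embed (L : ℝ) : H3 L × ℝ →L[ℝ] State L :=
  (WithLp.prodContinuousLinearEquiv 2 ℝ (L2 L) ℝ).symm.toContinuousLinearMap.comp
    ((DL 0).prodMap (ContinuousLinearMap.id ℝ ℝ))

lemma embed_apply (w : H3 L × ℝ) : embed L w = WithLp.toLp 2 (D 0 w.1, w.2) := rfl

lemma embed_injective : Function.Injective (embed L) := fun v w h => by
  have h' : (D 0 v.1, v.2) = (D 0 w.1, w.2) := congrArg WithLp.ofLp h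
  exact Prod.ext (D_injective (Prod.mk.inj h').1) (Prod.mk.inj h').2

/-- The trace is defined by a choice, so linearity is read off from continuous representatives. -/
lemma trace_add (hL : 0 < L) (u v : H3 L) {x : ℝ} (hx : x ∈ Icc 0 L) :
    trace (D 0 (u + v)) x = trace (D 0 u) x + trace (D 0 v) x ∧
      trace (D 1 (u + v)) x = trace (D 1 u) x + trace (D 1 v) x := by
  obtain ⟨y, y₁, y₂, y₃, hy⟩ := exists_isRep hL u
  obtain ⟨w, w₁, w₂, w₃, hw⟩ := exists_isRep hL v
  rw [hy.trace_eq hL hx, hy.trace_eq₁ hL hx, hw.trace_eq hL hx, hw.trace_eq₁ hL hx]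
  exact ⟨trace_eq hL (hy.continuous.add hw.continuous).continuousOn
      ((Lp.coeFn_add (D 0 u) (D 0 v)).trans (hy.ae_eq.add hw.ae_eq)) hx,
    trace_eq hL (hy.continuous₁.add hw.continuous₁).continuousOn
      ((Lp.coeFn_add (D 1 u) (D 1 v)).trans (hy.ae_eq₁.add hw.ae_eq₁)) hx⟩

lemma trace_smul (hL : 0 < L) (r : ℝ) (u : H3 L) {x : ℝ} (hx : x ∈ Icc 0 L) :
    trace (D 0 (r • u)) x = r * trace (D 0 u) x ∧
      trace (D 1 (r • u)) x = r * trace (D 1 u) x := by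
  obtain ⟨y, y₁, y₂, y₃, hy⟩ := exists_isRep hL u
  rw [hy.trace_eq hL hx, hy.trace_eq₁ hL hx]
  exact ⟨trace_eq hL (hy.continuous.const_smul r).continuousOn
      ((Lp.coeFn_smul r (D 0 u)).trans (hy.ae_eq.const_smul r)) hx,
    trace_eq hL (hy.continuous₁.const_smul r).continuousOn
      ((Lp.coeFn_smul r (D 1 u)).trans (hy.ae_eq₁.const_smul r)) hx⟩

/-- The trace of `u ∈ H³(0,L)` at `x ∈ [0,L]`. -/
def traceₗ (hL : 0 < L) {x : ℝ} (hx : x ∈ Icc 0 L) : H3 L →ₗ[ℝ] ℝ where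
  toFun u := trace (D 0 u) x
  map_add' u v := (trace_add hL u v hx).1
  map_smul' r u := (trace_smul hL r u hx).1

/-- The trace of the derivative of `u ∈ H³(0,L)` at `x ∈ [0,L]`. -/
def slopeₗ (hL : 0 < L) {x : ℝ} (hx : x ∈ Icc 0 L) : H3 L →ₗ[ℝ] ℝ where
  toFun u := trace (D 1 u) x
  map_add' u v := (trace_add hL u v hx).2
  map_smul' r u := (trace_smul hL r u hx).2

/-- The domain of the generator: the pairs that satisfy the boundary conditions. -/
def domain (hL : 0 < L) (a : ℝ) : Submodule ℝ (H3 L × ℝ) :=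
  LinearMap.ker (traceₗ hL (left_mem_Icc.2 hL.le) ∘ₗ LinearMap.fst ℝ _ _) ⊓
    LinearMap.ker (traceₗ hL (right_mem_Icc.2 hL.le) ∘ₗ LinearMap.fst ℝ _ _) ⊓
    LinearMap.ker (slopeₗ hL (right_mem_Icc.2 hL.le) ∘ₗ LinearMap.fst ℝ _ _ -
      a • LinearMap.snd ℝ _ _)

lemma mem_domain (hL : 0 < L) {a : ℝ} {w : H3 L × ℝ} : w ∈ domain hL a ↔
    trace (D 0 w.1) 0 = 0 ∧ trace (D 0 w.1) L = 0 ∧ trace (D 1 w.1) L = a * w.2 := by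
  rw [← sub_eq_zero (a := trace (D 1 w.1) L), ← and_assoc]
  rfl

/-- The generator `(y, z) ↦ (- y' - y''', b z + c y'(0))`. -/
def generator (hL : 0 < L) (b c : ℝ) : H3 L × ℝ →ₗ[ℝ] State L :=
  (WithLp.linearEquiv 2 ℝ (L2 L × ℝ)).symm.toLinearMap ∘ₗ
    ((-(DL 1).toLinearMap - (DL 3).toLinearMap) ∘ₗ LinearMap.fst ℝ _ _).prod
      (b • LinearMap.snd ℝ _ _ + c • (slopeₗ hL (left_mem_Icc.2 hL.le) ∘ₗ LinearMap.fst ℝ _ _))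

lemma generator_apply (hL : 0 < L) (b c : ℝ) (w : H3 L × ℝ) : generator hL b c w =
    WithLp.toLp 2 (-D 1 w.1 - D 3 w.1, b * w.2 + c * trace (D 1 w.1) 0) := rfl

lemma inner_eq_integral (hL : 0 ≤ L) {u v : L2 L} {f g : ℝ → ℝ}
    (hu : u =ᵐ[volume.restrict (Ioo 0 L)] f) (hv : v =ᵐ[volume.restrict (Ioo 0 L)] g) :
    inner ℝ u v = ∫ x in (0 : ℝ)..L, f x * g x := by
  rw [L2.inner_def, ← setIntegral_Ioo hL]
  refine integral_congr_ae ?_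
  filter_upwards [hu, hv] with x hx hx'
  simp [hx, hx', mul_comm]

lemma IsRep.neg_sub_ae_eq {u : H3 L} {y y₁ y₂ y₃ : ℝ → ℝ} (h : IsRep u y y₁ y₂ y₃) :
    (-D 1 u - D 3 u : L2 L) =ᵐ[volume.restrict (Ioo 0 L)] fun x => -(y₁ x + y₃ x) := by
  filter_upwards [Lp.coeFn_sub (-D 1 u) (D 3 u), Lp.coeFn_neg (D 1 u), h.ae_eq₁, h.ae_eq₃]
    with x h1 h2 h3 h4
  rw [h1, Pi.sub_apply, h2, Pi.neg_apply, h3, h4]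
  ring

/-- `IsJet.energy` and `boundary_form_le` bound the product by `κ z²`; `0 ≤ κ` allows adding `κ
‖y‖²`. -/
lemma inner_generator_le (hL : 0 < L) {a b c κ : ℝ} (hκ : a ^ 2 / 2 + b + c ^ 2 / 2 ≤ κ)
    (hκ₀ : 0 ≤ κ) {w : H3 L × ℝ} (hw : w ∈ domain hL a) :
    inner ℝ (generator hL b c w) (embed L w) ≤ κ * ‖embed L w‖ ^ 2 := by
  obtain ⟨h₀, h₁, h₂⟩ := (mem_domain hL).1 hw
  obtain ⟨y, y₁, y₂, y₃, hy⟩ := exists_isRep hL w.1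
  rw [hy.trace_eq hL (left_mem_Icc.2 hL.le)] at h₀
  rw [hy.trace_eq hL (right_mem_Icc.2 hL.le)] at h₁
  rw [hy.trace_eq₁ hL (right_mem_Icc.2 hL.le)] at h₂
  rw [← real_inner_self_eq_norm_sq, generator_apply, embed_apply, WithLp.prod_inner_apply,
    WithLp.prod_inner_apply, hy.trace_eq₁ hL (left_mem_Icc.2 hL.le)]
  simp only
  rw [inner_eq_integral hL.le hy.neg_sub_ae_eq hy.ae_eq]
  have h3 := hy.energy hL.le h₀ h₁
  have h4 : ∫ x in (0 : ℝ)..L, -(y₁ x + y₃ x) * y x =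
      -∫ x in (0 : ℝ)..L, (y₁ x + y₃ x) * y x := by
    rw [← intervalIntegral.integral_neg]
    exact intervalIntegral.integral_congr fun x _ => by ring
  have h5 := boundary_form_le hκ (y₁ 0) w.2
  have h6 : 0 ≤ κ * inner ℝ (D 0 w.1) (D 0 w.1) := mul_nonneg hκ₀ real_inner_self_nonneg
  rw [h4, h3, h₂, mul_add, real_inner_eq_re_inner, real_inner_eq_re_inner]
  simp only [RCLike.inner_apply, conj_trivial, RCLike.re_to_real]
  nlinarith

/-- The solution of the boundary value problem lies in `H³` because the equation expresses `y'''`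
through square-integrable functions. -/
lemma exists_resolvent_eq (hL : 0 < L) {a b c l κ : ℝ} (hκ₀ : 0 ≤ κ)
    (hκ : a ^ 2 / 2 + b + c ^ 2 / 2 ≤ κ) (hl : κ < l) (x : State L) :
    ∃ w ∈ domain hL a, l • embed L w - generator hL b c w = x := by
  obtain ⟨y, y₁, y₂, z, hj, -, hy0, hyL, hz, hg⟩ := exists_boundary_value_problem hL hκ₀ hκ hl
    (fun p q => (integrable_indicator x.fst).intervalIntegrable) x.snd
  have h₃ : MemLp (fun s => (Ioo 0 L).indicator x.fst s - l * y s - y₁ s) 2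
      (volume.restrict (Ioo 0 L)) :=
    (((memLp_congr_ae (indicator_ae_eq x.fst)).1 (Lp.memLp x.fst)).sub
      ((memLp_of_continuous hj.continuous).const_mul l)).sub (memLp_of_continuous hj.continuous₁)
  obtain ⟨u, hu⟩ := hj.exists_H3_isRep hL.le h₃
  refine ⟨(u, z), (mem_domain hL).2 ⟨?_, ?_, ?_⟩, ?_⟩
  · rw [hu.trace_eq hL (left_mem_Icc.2 hL.le), hy0]
  · rw [hu.trace_eq hL (right_mem_Icc.2 hL.le), hyL]
  · rw [hu.trace_eq₁ hL (right_mem_Icc.2 hL.le), hz]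
  · have h1 : l • D 0 u - (-D 1 u - D 3 u) = x.fst := by
      refine Lp.ext ?_
      filter_upwards [Lp.coeFn_sub (l • D 0 u) (-D 1 u - D 3 u), Lp.coeFn_smul l (D 0 u),
        hu.neg_sub_ae_eq, hu.ae_eq, indicator_ae_eq x.fst] with s e₁ e₂ e₃ e₄ e₅
      rw [e₁, Pi.sub_apply, e₂, Pi.smul_apply, e₃, e₄, e₅, smul_eq_mul]
      ring
    have h2 : l * z - (b * z + c * trace (D 1 u) 0) = x.snd := by
      rw [hu.trace_eq₁ hL (left_mem_Icc.2 hL.le), ← hg]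
      ring
    exact congrArg (WithLp.toLp 2) (Prod.ext h1 h2)

/-- The embedding of the domain of the generator into the state space. -/
def domainEmbed (hL : 0 < L) (a : ℝ) : domain hL a →ₗ[ℝ] State L :=
  (embed L).toLinearMap ∘ₗ (domain hL a).subtype

/-- The generator on its domain. -/
def domainGenerator (hL : 0 < L) (a b c : ℝ) : domain hL a →ₗ[ℝ] State L :=
  generator hL b c ∘ₗ (domain hL a).subtype

theorem isMDissipative (hL : 0 < L) {a b c κ : ℝ} (hκ₀ : 0 ≤ κ)
    (hκ : a ^ 2 / 2 + b + c ^ 2 / 2 ≤ κ) :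
    IsMDissipative (domainEmbed hL a) (domainGenerator hL a b c - κ • domainEmbed hL a) where
  injective := embed_injective.comp Subtype.val_injective
  dissipative e := by
    rw [LinearMap.sub_apply, LinearMap.smul_apply, inner_sub_left, real_inner_smul_left,
      real_inner_self_eq_norm_sq]
    exact sub_nonpos.2 (inner_generator_le hL hκ hκ₀ e.2)
  surjective l hl x := by
    obtain ⟨w, hw, h⟩ := exists_resolvent_eq hL hκ₀ hκ (lt_add_of_pos_left κ hl) x
    refine ⟨⟨w, hw⟩, ?_⟩
    rw [← h, LinearMap.sub_apply, LinearMap.smul_apply]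
    change l • embed L w - (generator hL b c w - κ • embed L w) = _
    module

/-- The resolvent is bounded as a map into `H³(0,L) × ℝ`. -/
lemma continuous_resolvent (hL : 0 < L) {a : ℝ} {B : domain hL a →ₗ[ℝ] State L}
    (h : IsMDissipative (domainEmbed hL a) B) (l : ℝ) :
    Continuous fun x => (h.resolvent l x : H3 L × ℝ) := by
  -- Closed graph: after the continuous injection `embed`, both limits are limits of the resolvent
  -- bounded on the state space.
  refine LinearMap.continuous_of_seq_closed_graph ((domain hL a).subtype ∘ₗ h.resolvent l)
    fun u x w hx hw => embed_injective ?_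
  have h1 := ((embed L).continuous.tendsto w).comp hw
  have h2 := ((h.resolventL l).continuous.tendsto x).comp hx
  exact tendsto_nhds_unique h1 h2

/-! ### Strong solutions. -/

section Strong

lemma contDiffOn_one_of_hasDerivWithinAt {V : Type*} [NormedAddCommGroup V] [NormedSpace ℝ V]
    {f f' : ℝ → V} (hf : ∀ t ∈ Ici (0 : ℝ), HasDerivWithinAt f (f' t) (Ici 0) t)
    (hf' : ContinuousOn f' (Ici 0)) : ContDiffOn ℝ 1 f (Ici 0) :=
  (contDiffOn_one_iff_derivWithin (uniqueDiffOn_Ici 0)).2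
    ⟨fun t ht => (hf t ht).differentiableWithinAt, hf'.congr fun t ht =>
      (hf t ht).derivWithin (uniqueDiffOn_Ici 0 t ht)⟩

variable {a b c : ℝ} {y₀ : H3 L} {z₀ : ℝ}

lemma isStrongSolution_of_hasDerivWithinAt (hL : 0 < L) {w : ℝ → H3 L × ℝ} {v : ℝ → State L}
    (hw : ContinuousOn w (Ici 0)) (hdom : ∀ t, w t ∈ domain hL a) (h₀ : w 0 = (y₀, z₀))
    (hv : ContinuousOn v (Ici 0)) (hgen : ∀ t, generator hL b c (w t) = v t)
    (hd : ∀ t ∈ Ici (0 : ℝ), HasDerivWithinAt (fun t => embed L (w t)) (v t) (Ici 0) t) :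
    IsStrongSolution a b c y₀ z₀ (fun t => (w t).1) fun t => (w t).2 := by
  have d₁ : ∀ t ∈ Ici (0 : ℝ),
      HasDerivWithinAt (fun t => D 0 (w t).1) (v t).fst (Ici 0) t := fun t ht =>
    (WithLp.fstL 2 ℝ (L2 L) ℝ).hasFDerivAt.comp_hasDerivWithinAt t (hd t ht)
  have d₂ : ∀ t ∈ Ici (0 : ℝ), HasDerivWithinAt (fun t => (w t).2) (v t).snd (Ici 0) t :=
    fun t ht => ((WithLp.sndL 2 ℝ (L2 L) ℝ).hasFDerivAt (x := embed L (w t))).comp_hasDerivWithinAt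
      (f := fun t => embed L (w t)) t (hd t ht)
  exact
    { continuousOn_H3 := hw.fst
      contDiffOn_L2 := contDiffOn_one_of_hasDerivWithinAt d₁
        ((WithLp.fstL 2 ℝ (L2 L) ℝ).continuous.comp_continuousOn hv)
      contDiffOn_z := contDiffOn_one_of_hasDerivWithinAt d₂
        ((WithLp.sndL 2 ℝ (L2 L) ℝ).continuous.comp_continuousOn hv)
      kdv := fun t ht => by
        rw [(d₁ t ht).derivWithin (uniqueDiffOn_Ici 0 t ht), ← hgen, generator_apply]
        simp only [WithLp.toLp_fst]
        abel
      left_end := fun t _ => ((mem_domain hL).1 (hdom t)).1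
      right_end := fun t _ => ((mem_domain hL).1 (hdom t)).2.1
      right_slope := fun t _ => ((mem_domain hL).1 (hdom t)).2.2
      ode := fun t ht => by
        rw [(d₂ t ht).derivWithin (uniqueDiffOn_Ici 0 t ht), ← hgen, generator_apply]
        rfl
      initial_y := by rw [h₀]
      initial_z := by rw [h₀] }

lemma IsStrongSolution.mem_domain (hL : 0 < L) {y : ℝ → H3 L} {z : ℝ → ℝ}
    (h : IsStrongSolution a b c y₀ z₀ y z) {t : ℝ} (ht : t ∈ Ici (0 : ℝ)) :
    (y t, z t) ∈ domain hL a :=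
  (KdVODE.mem_domain hL).2 ⟨h.left_end t ht, h.right_end t ht, h.right_slope t ht⟩

lemma IsStrongSolution.hasDerivWithinAt (hL : 0 < L) {y : ℝ → H3 L} {z : ℝ → ℝ}
    (h : IsStrongSolution a b c y₀ z₀ y z) {t : ℝ} (ht : t ∈ Ici (0 : ℝ)) :
    HasDerivWithinAt (fun t => embed L (y t, z t)) (generator hL b c (y t, z t)) (Ici 0) t := by
  have h1 := ((h.contDiffOn_L2.differentiableOn one_ne_zero) t ht).hasDerivWithinAt
  have h2 := ((h.contDiffOn_z.differentiableOn one_ne_zero) t ht).hasDerivWithinAt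
  have h3 := (WithLp.prodContinuousLinearEquiv 2 ℝ (L2 L) ℝ).symm.toContinuousLinearMap.hasFDerivAt
    |>.comp_hasDerivWithinAt t (h1.prodMk h2)
  refine h3.congr_deriv ?_
  rw [generator_apply]
  refine congrArg (WithLp.toLp 2) (Prod.ext ?_ (h.ode t ht))
  have h4 := h.kdv t ht
  rw [add_assoc] at h4
  simp only
  rw [eq_neg_of_add_eq_zero_left h4]
  abel

theorem exists_unique_strong (hL : 0 < L) (a b c : ℝ) (h₀ : trace (D 0 y₀) 0 = 0)
    (h₁ : trace (D 0 y₀) L = 0) (h₂ : trace (D 1 y₀) L = a * z₀) :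
    ∃ (y : ℝ → H3 L) (z : ℝ → ℝ), IsStrongSolution a b c y₀ z₀ y z ∧
      ∀ (y' : ℝ → H3 L) (z' : ℝ → ℝ), IsStrongSolution a b c y₀ z₀ y' z' →
        EqOn y' y (Ici 0) ∧ EqOn z' z (Ici 0) := by
  have h := isMDissipative hL (le_max_left 0 _) (le_max_right 0 (a ^ 2 / 2 + b + c ^ 2 / 2))
  set κ := max 0 (a ^ 2 / 2 + b + c ^ 2 / 2)
  obtain ⟨v, hv, hA, hv₀, hd⟩ := exists_classical_solution h
    ⟨(y₀, z₀), (mem_domain hL).2 ⟨h₀, h₁, h₂⟩⟩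
  let e : ℝ → domain hL a := fun t => h.resolvent 1 (v t)
  have hec : ContinuousOn (fun t => (e t : H3 L × ℝ)) (Ici 0) :=
    (continuous_resolvent hL h 1).comp_continuousOn hv
  have hAc : ContinuousOn (fun t => domainGenerator hL a b c (e t)) (Ici 0) :=
    ((((h.resolventL 1).continuous.comp_continuousOn hv).const_smul (1 + κ)).sub hv).congr
      fun t _ => hA t
  have he₀ : (e 0 : H3 L × ℝ) = (y₀, z₀) := congrArg Subtype.val hv₀
  have hed : ∀ t ∈ Ici (0 : ℝ), HasDerivWithinAt (fun t => domainEmbed hL a (e t))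
      (domainGenerator hL a b c (e t)) (Ici 0) t := fun t ht => (hd t ht).2
  clear_value e
  clear hd hA hv₀ hv
  refine ⟨_, _, isStrongSolution_of_hasDerivWithinAt hL hec (fun t => (e t).2) he₀ hAc
    (fun t => rfl) hed, fun y' z' h' => ?_⟩
  have key : ∀ t ∈ Ici (0 : ℝ), (y' t, z' t) = (e t : H3 L × ℝ) := by
    -- A competing solution is known to lie in the domain only for `t ≥ 0`; freezing it at its
    -- initial value before that gives a curve in the domain.
    have hmem : ∀ t : ℝ, (y' (max t 0), z' (max t 0)) ∈ domain hL a := fun t =>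
      h'.mem_domain hL (mem_Ici.2 (le_max_right t 0))
    have hmax : ∀ t ∈ Ici (0 : ℝ), max t 0 = t := fun t ht => max_eq_left ht
    let e' : ℝ → domain hL a := fun t => ⟨(y' (max t 0), z' (max t 0)), hmem t⟩
    have he' : ∀ t ∈ Ici (0 : ℝ), (e' t : H3 L × ℝ) = (y' t, z' t) := fun t ht => by
      simp only [e', hmax t ht]
    have hed' : ∀ t ∈ Ici (0 : ℝ), HasDerivWithinAt (fun t => domainEmbed hL a (e' t))
        (domainGenerator hL a b c (e' t)) (Ici 0) t := fun t ht => by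
      have h4 := h'.hasDerivWithinAt hL ht
      rw [← he' t ht] at h4
      exact h4.congr (fun s hs => congrArg (embed L) (he' s hs)) (congrArg (embed L) (he' t ht))
    intro t ht
    rw [← he' t ht, h.eqOn hed' hed (Subtype.ext ?_) ht]
    rw [he' 0 self_mem_Ici, h'.initial_y, h'.initial_z, he₀]
  exact ⟨fun t ht => congrArg Prod.fst (key t ht), fun t ht => congrArg Prod.snd (key t ht)⟩

end Strong

/-! ### Weak solutions. -/

section Weak

variable {a b c : ℝ}

lemma inner_test (u : L2 L) (z : ℝ) (φ : C(ℝ, ℝ)) (q : ℝ) :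
    inner ℝ (WithLp.toLp 2 (u, z) : State L) (WithLp.toLp 2 (ofContinuous L φ, q)) =
      (∫ x in Ioo 0 L, u x * φ x) + z * q := by
  rw [WithLp.prod_inner_apply, integral_mul_eq_inner]
  simp [mul_comm]

lemma continuous_iteratedDeriv {φ : ℝ → ℝ} (hφ : ContDiff ℝ ∞ φ) (n : ℕ) :
    Continuous (iteratedDeriv n φ) :=
  hφ.continuous_iteratedDeriv n (mod_cast le_top)

/-- A smooth function `φ`, as a continuous map. -/
def smoothMap {φ : ℝ → ℝ} (hφ : ContDiff ℝ ∞ φ) : C(ℝ, ℝ) := ⟨φ, hφ.continuous⟩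

/-- The function `φ' + φ'''`, as a continuous map. -/
def adjointMap {φ : ℝ → ℝ} (hφ : ContDiff ℝ ∞ φ) : C(ℝ, ℝ) :=
  ⟨fun x => deriv φ x + iteratedDeriv 3 φ x, (hφ.continuous_deriv (by simp)).add
    (continuous_iteratedDeriv hφ 3)⟩

/-- The pairs `(ψ, A* ψ)` for the test pairs `ψ = (φ, q)`. -/
def testPairs (L a b c : ℝ) : Set (State L × State L) :=
  {p | ∃ (φ : ℝ → ℝ) (q : ℝ) (hφ : ContDiff ℝ ∞ φ), φ 0 = 0 ∧ φ L = 0 ∧ deriv φ 0 = c * q ∧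
    p.1 = WithLp.toLp 2 (ofContinuous L (smoothMap hφ), q) ∧
    p.2 = WithLp.toLp 2 (ofContinuous L (adjointMap hφ), b * q + a * deriv φ L)}

lemma isJet_of_contDiff {φ : ℝ → ℝ} (hφ : ContDiff ℝ ∞ φ) :
    IsJet L φ (deriv φ) (iteratedDeriv 2 φ) (iteratedDeriv 3 φ) := by
  have hd : ∀ n : ℕ, ∀ x, HasDerivAt (iteratedDeriv n φ) (iteratedDeriv (n + 1) φ x) x :=
    fun n x => by
      rw [iteratedDeriv_succ]
      exact ((hφ.differentiable_iteratedDeriv n (mod_cast ENat.natCast_lt_top n)) x).hasDerivAt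
  have h0 := hd 0
  have h1 := hd 1
  simp only [iteratedDeriv_zero, zero_add, iteratedDeriv_one] at h0 h1
  exact ⟨h0, h1, continuous_iteratedDeriv hφ 2,
    isPrimitive_of_hasDerivAt (hd 2) (continuous_iteratedDeriv hφ 3)⟩

/-- Green's formula. The condition `φ'(0) = c q` cancels the terms with `y'(0)`, and `y'(L) = a z`
turns the boundary term at `L` into `a z φ'(L)`. -/
lemma inner_generator_eq (hL : 0 < L) {p : State L × State L} (hp : p ∈ testPairs L a b c)
    {w : H3 L × ℝ} (hw : w ∈ domain hL a) :
    inner ℝ (generator hL b c w) p.1 = inner ℝ (embed L w) p.2 := by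
  obtain ⟨φ, q, hφ, hφ0, hφL, hq, h1, h2⟩ := hp
  obtain ⟨h₀, h₁, h₂⟩ := (mem_domain hL).1 hw
  obtain ⟨y, y₁, y₂, y₃, hy⟩ := exists_isRep hL w.1
  rw [hy.trace_eq hL (left_mem_Icc.2 hL.le)] at h₀
  rw [hy.trace_eq hL (right_mem_Icc.2 hL.le)] at h₁
  rw [hy.trace_eq₁ hL (right_mem_Icc.2 hL.le)] at h₂
  have hj : IsJet L φ _ _ _ := isJet_of_contDiff hφ
  have hg := hy.green hL.le hj h₀ h₁ hφ0 hφL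
  rw [h1, h2, generator_apply, embed_apply, inner_test, inner_test,
    hy.trace_eq₁ hL (left_mem_Icc.2 hL.le)]
  have e₁ : ∫ x in Ioo 0 L, (-D 1 w.1 - D 3 w.1 : L2 L) x * smoothMap hφ x =
      ∫ x in (0 : ℝ)..L, -((y₁ x + y₃ x) * φ x) := by
    rw [← setIntegral_Ioo hL.le]
    refine integral_congr_ae ?_
    filter_upwards [hy.neg_sub_ae_eq] with x hx
    rw [hx, neg_mul]; rfl
  have e₂ : ∫ x in Ioo 0 L, D 0 w.1 x * adjointMap hφ x =
      ∫ x in (0 : ℝ)..L, y x * (deriv φ x + iteratedDeriv 3 φ x) := by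
    rw [← setIntegral_Ioo hL.le]
    refine integral_congr_ae ?_
    filter_upwards [hy.ae_eq] with x hx
    rw [hx]; rfl
  have hi₁ : IntervalIntegrable (fun x => (y₁ x + y₃ x) * φ x) volume 0 L :=
    ((hy.continuous₁.intervalIntegrable _ _).add hy.isPrimitive.1).mul_continuousOn
      hφ.continuous.continuousOn
  have hi₂ : IntervalIntegrable (fun x => y x * (deriv φ x + iteratedDeriv 3 φ x)) volume 0 L :=
    (hy.continuous.mul (adjointMap hφ).continuous).intervalIntegrable _ _
  rw [intervalIntegral.integral_add hi₁ hi₂] at hg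
  rw [e₁, e₂, intervalIntegral.integral_neg, add_mul, mul_add]
  rw [h₂, hq] at hg
  linarith

/-- The adjoint problem with `l = 1 + κ` represents every smooth `(f, g)` as `(1 + κ) ψ - A* ψ`, so
`x` is orthogonal to a dense set. -/
lemma eq_zero_of_inner_testPairs (hL : 0 < L) {κ : ℝ} (hκ₀ : 0 ≤ κ)
    (hκ : a ^ 2 / 2 + b + c ^ 2 / 2 ≤ κ) (x : State L)
    (hx : ∀ p ∈ testPairs L a b c, inner ℝ x ((1 + κ) • p.1 - p.2) = 0) : x = 0 := by
  have key : ∀ {f : ℝ → ℝ}, ContDiff ℝ ∞ f → ∀ g : ℝ,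
      (∫ s in Ioo 0 L, x.fst s * f s) + x.snd * g = 0 := by
    intro f hf g
    obtain ⟨φ, q, hφ, hφ0, hφL, hq, h1, h2⟩ := exists_adjoint_boundary_value_problem hL hκ₀ hκ
      (lt_add_of_pos_left κ one_pos) hf g
    have h3 := hx (_, _) ⟨φ, q, hφ, hφ0, hφL, hq, rfl, rfl⟩
    rw [inner_sub_right, real_inner_smul_right,
      show x = WithLp.toLp 2 (x.fst, x.snd) from rfl, inner_test, inner_test] at h3
    have h4 : ∫ s in Ioo 0 L, x.fst s * f s = (1 + κ) * (∫ s in Ioo 0 L, x.fst s * smoothMap hφ s) -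
        ∫ s in Ioo 0 L, x.fst s * adjointMap hφ s := by
      rw [← integral_const_mul, ← integral_sub ((integrable_mul _ (smoothMap hφ).continuous).const_mul _)
        (integrable_mul _ (adjointMap hφ).continuous)]
      refine integral_congr_ae (ae_of_all _ fun s => ?_)
      simp only [← h1, smoothMap, adjointMap, ContinuousMap.coe_mk]
      ring
    rw [h4, ← h2]
    linear_combination h3
  have e₁ : x.fst = 0 := eq_zero_of_integral_mul_eq_zero fun φ hφ _ _ => by
    simpa using key hφ 0
  have e₂ : x.snd = 0 := by
    have := key (f := fun _ => 0) contDiff_const 1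
    simpa using this
  exact congrArg (WithLp.toLp 2) (Prod.ext e₁ e₂)

lemma isWeakSolution_iff {y₀ : L2 L} {z₀ : ℝ} {y : ℝ → L2 L} {z : ℝ → ℝ} :
    IsWeakSolution a b c y₀ z₀ y z ↔
      ContinuousOn (fun t => (WithLp.toLp 2 (y t, z t) : State L)) (Ici 0) ∧ y 0 = y₀ ∧ z 0 = z₀ ∧
      ∀ p ∈ testPairs L a b c, ∀ t ∈ Ici (0 : ℝ),
        inner ℝ (WithLp.toLp 2 (y t, z t) : State L) p.1 =
          inner ℝ (WithLp.toLp 2 (y₀, z₀) : State L) p.1 +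
            ∫ s in (0 : ℝ)..t, inner ℝ (WithLp.toLp 2 (y s, z s) : State L) p.2 := by
  constructor
  · intro h
    refine ⟨(WithLp.prodContinuousLinearEquiv 2 ℝ (L2 L) ℝ).symm.continuous.comp_continuousOn
      (h.continuousOn_L2.prodMk h.continuousOn_z), h.initial_y, h.initial_z, ?_⟩
    rintro ⟨_, _⟩ ⟨φ, q, hφ, hφ0, hφL, hq, rfl, rfl⟩ t ht
    simp only [inner_test]
    exact h.weak φ q hφ hφ0 hφL hq t ht
  · rintro ⟨hc, hy, hz, hw⟩
    refine ⟨(WithLp.fstL 2 ℝ (L2 L) ℝ).continuous.comp_continuousOn hc,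
      (WithLp.sndL 2 ℝ (L2 L) ℝ).continuous.comp_continuousOn hc, hy, hz,
      fun φ q hφ hφ0 hφL hq t ht => ?_⟩
    have h1 := hw (_, _) ⟨φ, q, hφ, hφ0, hφL, hq, rfl, rfl⟩ t ht
    simp only [inner_test] at h1
    exact h1

theorem exists_unique_weak (hL : 0 < L) (a b c : ℝ) (y₀ : L2 L) (z₀ : ℝ) :
    ∃ (y : ℝ → L2 L) (z : ℝ → ℝ), IsWeakSolution a b c y₀ z₀ y z ∧
      ∀ (y' : ℝ → L2 L) (z' : ℝ → ℝ), IsWeakSolution a b c y₀ z₀ y' z' →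
        EqOn y' y (Ici 0) ∧ EqOn z' z (Ici 0) := by
  have h := isMDissipative hL (le_max_left 0 _) (le_max_right 0 (a ^ 2 / 2 + b + c ^ 2 / 2))
  have hT := eq_zero_of_inner_testPairs hL (le_max_left 0 _)
    (le_max_right 0 (a ^ 2 / 2 + b + c ^ 2 / 2))
  set κ := max 0 (a ^ 2 / 2 + b + c ^ 2 / 2)
  have hgen : ∀ p ∈ testPairs L a b c, ∀ e : domain hL a,
      inner ℝ (domainGenerator hL a b c e) p.1 = inner ℝ (domainEmbed hL a e) p.2 :=
    fun p hp e => inner_generator_eq hL hp e.2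
  let w₀ : State L := WithLp.toLp 2 (y₀, z₀)
  let w : ℝ → State L := fun t => Real.exp (κ * t) • h.semigroup t w₀
  have hexp : Continuous fun t : ℝ => Real.exp (κ * t) := by fun_prop
  have hwc : ContinuousOn w (Ici 0) := hexp.continuousOn.smul (h.continuousOn_semigroup w₀)
  have hw₀ : w 0 = w₀ := by simp [w, h.semigroup_zero]
  have hsol : IsWeakSolution a b c y₀ z₀ (fun t => (w t).fst) fun t => (w t).snd :=
    isWeakSolution_iff.2 ⟨hwc, by rw [hw₀]; rfl, by rw [hw₀]; rfl,
      fun p hp t ht => h.inner_semigroup (hgen p hp) w₀ ht⟩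
  refine ⟨_, _, hsol, fun y' z' h' => ?_⟩
  obtain ⟨hc', -, -, hw'⟩ := isWeakSolution_iff.1 h'
  obtain ⟨-, -, -, hw⟩ := isWeakSolution_iff.1 hsol
  have key : ∀ t ∈ Ici (0 : ℝ), (WithLp.toLp 2 (y' t, z' t) : State L) = w t := by
    intro t ht
    refine sub_eq_zero.1 (h.eq_zero_of_weak hgen hT
      (w := fun t => (WithLp.toLp 2 (y' t, z' t) : State L) - w t) (hc'.sub hwc)
      (fun p hp t ht => ?_) ht)
    have hi : ∀ {v : ℝ → State L}, ContinuousOn v (Ici 0) →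
        IntervalIntegrable (fun s => inner ℝ (v s) p.2) volume 0 t := fun hv =>
      ((hv.inner continuousOn_const).mono
        (by rw [uIcc_of_le ht]; exact Icc_subset_Ici_self)).intervalIntegrable
    simp only [inner_sub_left]
    rw [intervalIntegral.integral_sub (hi hc') (hi hwc), hw' p hp t ht]
    have h1 := hw p hp t ht
    change inner ℝ (w t) p.1 = _ + ∫ s in (0 : ℝ)..t, inner ℝ (w s) p.2 at h1
    rw [h1]
    ring
  exact ⟨fun t ht => congrArg WithLp.fst (key t ht), fun t ht => congrArg WithLp.snd (key t ht)⟩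

end Weak

end System

end KdVODE

end

theorem mainTheorem1 (L : ℝ) (hL : 0 < L) (a b c : ℝ) :
    (∀ (y₀ : KdVODE.H3 L) (z₀ : ℝ),
      KdVODE.trace (KdVODE.D 0 y₀) 0 = 0 → KdVODE.trace (KdVODE.D 0 y₀) L = 0 →
      KdVODE.trace (KdVODE.D 1 y₀) L = a * z₀ →
      ∃ (y : ℝ → KdVODE.H3 L) (z : ℝ → ℝ), KdVODE.IsStrongSolution a b c y₀ z₀ y z ∧
        ∀ (y' : ℝ → KdVODE.H3 L) (z' : ℝ → ℝ), KdVODE.IsStrongSolution a b c y₀ z₀ y' z' →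
          Set.EqOn y' y (Set.Ici 0) ∧ Set.EqOn z' z (Set.Ici 0)) ∧
    (∀ (y₀ : KdVODE.L2 L) (z₀ : ℝ),
      ∃ (y : ℝ → KdVODE.L2 L) (z : ℝ → ℝ), KdVODE.IsWeakSolution a b c y₀ z₀ y z ∧
        ∀ (y' : ℝ → KdVODE.L2 L) (z' : ℝ → ℝ), KdVODE.IsWeakSolution a b c y₀ z₀ y' z' →
          Set.EqOn y' y (Set.Ici 0) ∧ Set.EqOn z' z (Set.Ici 0)) :=
  ⟨fun _ _ h₀ h₁ h₂ => KdVODE.exists_unique_strong hL a b c h₀ h₁ h₂,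
    fun y₀ z₀ => KdVODE.exists_unique_weak hL a b c y₀ z₀⟩
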